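/- Let $\Delta$ be a (finite) reduced crystallographic root system over a field of characteristic $0$, for example the root system of a finite-dimensional simple Lie algebra over $\mathbb{C}$, with simple roots $\alpha_i$ $(i\in I)$, positive roots $\Delta^+$, and $\rho=\frac12\sum_{\alpha\in\Delta^+}\alpha$. Let $W$ be its Weyl group, with simple reflections $s_i$, length function $\ell$, longest element $w_0$ and Bruhat order $\ge$. The quantum Bruhat graph of $W$ is the directed graph with vertex set $W$ and an edge $u\xrightarrow{\beta}us_\beta$ labelled by $\beta\in\Delta^+$ whenever $\ell(us_\beta)=\ell(u)+1$ or $\ell(us_\beta)=\ell(u)+1-2\langle\rho,\beta^\vee\rangle$. Write $\ell(u\Rightarrow v)$ for the length of a shortest directed path from $u$ to $v$ in it. For $w\in W$, the $w$-tilted Bruhat order is defined by: $u\le_w v$ if and only if $\ell(w\Rightarrow v)=\ell(w\Rightarrow u)+\ell(u\Rightarrow v)$. Let $w\in W$. Choose a reduced expression $w=s_{i_1}\cdots s_{i_p}$ and $i_{-q},\dots,i_0\in I$ such that $s_{i_{-q}}\cdots s_{i_0}s_{i_1}\cdots s_{i_p}$ is a reduced expression for $w_0$; such a choice exists. Set $\beta_k=s_{i_p}\cdots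 s_{i_{k+1}}\alpha_{i_k}\in\Delta^+$ for $-q\le k\le p$. Define $\mathrm{EQB}(w)$ as the set of all $u\in W$ for which there is a shortest directed path $w=x_0\xrightarrow{\beta_{j_1}}x_1\to\cdots\xrightarrow{\beta_{j_s}}x_s=u$ in the quantum Bruhat graph with $j_1<\cdots<j_s$ and, if $s\geq 1$, $j_1\ge 1$. Then, for every such choice of reduced expressions, $$\mathrm{EQB}(w)=\{u\in W \mid \text{there is no } z\in W \text{ with } z>w \text{ and } z\le_w u\}.$$ Equivalently, $\mathrm{EQB}(w)$ is the set of $u\in W$ such that no shortest directed path from $w$ to $u$ in the quantum Bruhat graph passes through an element $z>w$. -/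

import Mathlib

namespace QuantumBruhat

open RootPairing

section

variable {ι K M N : Type*} [Fintype ι] [Field K] [CharZero K]
  [AddCommGroup M] [Module K M] [AddCommGroup N] [Module K N]
  {P : RootPairing ι K M N} [P.IsCrystallographic] [P.IsReduced]

/-- The reflection `s_β` in the Weyl group `W` attached to the root with index `β`. -/
noncomputable def refl (P : RootPairing ι K M N) (β : ι) : P.weylGroup :=
  weylGroup.ofIdx P β

/-- The product `s_{i₁} ⋯ s_{iₙ}` of a word in the simple reflections. -/
noncomputable def wordProd (b : P.Base) (l : List b.support) : P.weylGroup :=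
  (l.map fun i => refl P (i : ι)).prod

/-- The length `ℓ(w)`: the smallest number of simple reflections in an expression for `w`. -/
noncomputable def len (b : P.Base) (w : P.weylGroup) : ℕ :=
  sInf {n | ∃ l : List b.support, wordProd b l = w ∧ l.length = n}

/-- `l` is a reduced expression for `w`. -/
def IsReducedWord (b : P.Base) (l : List b.support) (w : P.weylGroup) : Prop :=
  wordProd b l = w ∧ l.length = len b w

/-- `w` is the longest element of the Weyl group. -/
def IsLongest (b : P.Base) (w : P.weylGroup) : Prop :=
  ∀ x : P.weylGroup, len b x ≤ len b w

/-- The strict (ordinary) Bruhat order `u < v` on `W`: the transitive closure of the relation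
"`v = u s_β` for some root `β`, and `ℓ(u) < ℓ(v)`". -/
def BruhatLT (b : P.Base) : P.weylGroup → P.weylGroup → Prop :=
  Relation.TransGen fun u v => (∃ β : ι, v = u * refl P β) ∧ len b u < len b v

open Classical in
/-- The integer `⟨2ρ, β^∨⟩`, where `2ρ` is the sum of the positive roots. -/
noncomputable def twoRho (b : P.Base) (β : ι) : ℤ :=
  ∑ α : ι with b.IsPos α, P.pairingIn ℤ α β

/-- There is an edge `u → v` labelled by the positive root `β` in the quantum Bruhat graph of `W`:
`v = u s_β`, and `ℓ(v) = ℓ(u) + 1` (Bruhat edge) or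
`ℓ(v) = ℓ(u) + 1 - 2⟨ρ, β^∨⟩` (quantum edge). -/
def IsEdge (b : P.Base) (u : P.weylGroup) (β : ι) (v : P.weylGroup) : Prop :=
  b.IsPos β ∧ v = u * refl P β ∧
    ((len b v : ℤ) = len b u + 1 ∨ (len b v : ℤ) = len b u + 1 - twoRho b β)

/-- `IsPath b u L v`: the list `L` is the list of labels of a directed path from `u` to `v` in the
quantum Bruhat graph. (A path is determined by its starting point and its labels.) -/
inductive IsPath (b : P.Base) : P.weylGroup → List ι → P.weylGroup → Prop
  | nil (u : P.weylGroup) : IsPath b u [] u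
  | cons {u x v : P.weylGroup} {β : ι} {L : List ι} :
      IsEdge b u β x → IsPath b x L v → IsPath b u (β :: L) v

/-- `ℓ(u ⇒ v)`: the length of a shortest directed path from `u` to `v` in the quantum Bruhat
graph. -/
noncomputable def dist (b : P.Base) (u v : P.weylGroup) : ℕ :=
  sInf {n | ∃ L : List ι, IsPath b u L v ∧ L.length = n}

/-- The `w`-tilted Bruhat order `u ≤_w v`. -/
def TiltedLE (b : P.Base) (w u v : P.weylGroup) : Prop :=
  dist b w v = dist b w u + dist b u v

/-- The choice made in the definition of `EQB(w)`: a reduced expression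
`w = s_{i_1} ⋯ s_{i_p}` (the list `right`), and `i_{-q}, …, i_0` (the list `left`) such that
`s_{i_{-q}} ⋯ s_{i_0} s_{i_1} ⋯ s_{i_p}` is a reduced expression for the longest element. -/
structure ReducedExtension (b : P.Base) (w : P.weylGroup) where
  right : List b.support
  left : List b.support
  right_reduced : IsReducedWord b right w
  word_reduced : IsReducedWord b (left ++ right) (wordProd b (left ++ right))
  word_longest : IsLongest b (wordProd b (left ++ right))

/-- The full word `i_{-q}, …, i_p`. -/
def ReducedExtension.word {b : P.Base} {w : P.weylGroup} (c : ReducedExtension b w) :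
    List b.support :=
  c.left ++ c.right

/-- The root `β_k = s_{i_p} ⋯ s_{i_{k+1}} α_{i_k}` (as an index in `ι`). Positions in the word are
numbered from `0`, so that `k` corresponds to the position `k + q`, where `q + 1` is the length of
`left`; in particular `k ≥ 1` means that the position is at least the length of `left`. -/
noncomputable def ReducedExtension.beta {b : P.Base} {w : P.weylGroup} (c : ReducedExtension b w)
    (k : Fin c.word.length) : ι :=
  P.weylGroupToPerm (wordProd b (c.word.drop (k + 1)))⁻¹ (c.word.get k : ι)

/-- `j = (j_1, …, j_s)` is the list of positions of the labels of a label-increasing shortest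
directed path from `w` to `u`: `j_1 < ⋯ < j_s`, and `β_{j_1}, …, β_{j_s}` are the labels of a
shortest directed path from `w` to `u` in the quantum Bruhat graph. -/
def ReducedExtension.IsIncreasingPath {b : P.Base} {w : P.weylGroup} (c : ReducedExtension b w)
    (u : P.weylGroup) (j : List (Fin c.word.length)) : Prop :=
  j.Pairwise (· < ·) ∧ IsPath b w (j.map c.beta) u ∧ j.length = dist b w u

/-- The set `EQB(w)`, for a given choice of reduced expressions: all `u` whose label-increasing
shortest directed path from `w` to `u` satisfies `j_1 ≥ 1` (no condition if the path is trivial,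
that is, if `u = w`). -/
def EQB {b : P.Base} {w : P.weylGroup} (c : ReducedExtension b w) : Set P.weylGroup :=
  {u | ∃ j : List (Fin c.word.length), c.IsIncreasingPath u j ∧
    ∀ j₁ ∈ j.head?, c.left.length ≤ (j₁ : ℕ)}

end

end QuantumBruhat

/-! The `β_k` enumerate the positive roots in a reflection order whose final part, `k ≥ 1`, is
exactly the inversion set of `w`. For any reflection order there is a unique label-increasing path
between two given elements, and it is shortest (`increasing_path`, `IsIncPath.unique`). So `u` lies
in `EQB` iff the increasing path from `w` to `u` is empty or starts with an inversion of `w`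
(`mem_EQB_iff`).

If its first label `β` is not an inversion, its first edge already goes to `w s_β > w`. Conversely,
suppose that some `z > w` lies on a shortest path to `u`, and let `k` be the first label of the
increasing path from `w` to `z`. If `k` were an inversion, so would be all later labels, and the
path would amount to deleting letters from a reduced word of `w`, giving `ℓ(z) ≤ ℓ(w)`
(`len_le_of_isIncPath`). So `k` is not an inversion. The first label of the increasing path to `u`
is at most that of any other shortest path (`exists_isIncPath_head_le`), hence at most `k`, hence
not an inversion either.

The facts about increasing paths rest on left multiplication by `s_a`, where `a` is simple or the
negative of a highest root (`IsAffineSimple`). Such an `s_a` carries edges to edges unless they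
cross from one side of `a` to the other, and an edge from the positive to the negative side is `x →
s_a x`. Paths can thus be reflected, with one crossing edge deleted or inserted. The recursion
`tilted_induction` terminates because a set of counterexamples with fixed `u⁻¹v` would be closed
under all such moves; summing heights over this set shows that it is all of `W`, which is absurd. -/

namespace QuantumBruhat

open RootPairing

set_option linter.unusedSectionVars false

section

variable {ι K M N : Type*} [Fintype ι] [Field K] [CharZero K]
  [AddCommGroup M] [Module K M] [AddCommGroup N] [Module K N]
  {P : RootPairing ι K M N}

/-! ### Reflections acting on roots, pairings and heights -/

theorem root_smul (w : P.weylGroup) (i : ι) : P.root (w • i) = w • P.root i :=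
  (weylGroup_apply_root P w i).symm

theorem refl_smul (β i : ι) : refl P β • i = P.reflectionPerm β i := rfl

theorem refl_smul_weight (β : ι) (x : M) : refl P β • x = P.reflection β x := rfl

theorem weylGroup_ext {x y : P.weylGroup} (h : ∀ m : M, x • m = y • m) : x = y := by
  apply Subtype.ext
  apply Equiv.weightHom_injective P
  ext m
  exact h m

@[simp] theorem refl_mul_self (β : ι) : refl P β * refl P β = 1 := by
  apply weylGroup_ext
  intro m
  rw [mul_smul, refl_smul_weight, refl_smul_weight, reflection_same, one_smul]

@[simp] theorem refl_inv (β : ι) : (refl P β)⁻¹ = refl P β :=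
  inv_eq_of_mul_eq_one_left (refl_mul_self β)

@[simp] theorem mul_refl_mul_refl (x : P.weylGroup) (β : ι) : x * refl P β * refl P β = x := by
  rw [mul_assoc, refl_mul_self, mul_one]

@[simp] theorem refl_mul_refl_mul (x : P.weylGroup) (β : ι) : refl P β * (refl P β * x) = x := by
  rw [← mul_assoc, refl_mul_self, one_mul]

@[simp] theorem refl_smul_refl_smul (β i : ι) : refl P β • refl P β • i = i := by
  rw [← mul_smul, refl_mul_self, one_smul]

theorem weylGroup_induction {p : P.weylGroup → Prop} (one : p 1)
    (mul : ∀ β w, p w → p (refl P β * w)) (w : P.weylGroup) : p w := by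
  have key : ∀ (x : P.weylGroup) (y : P.weylGroup), p y → p (x * y) := by
    rintro ⟨x, hx⟩
    induction hx using weylGroup.induction with
    | mem i => exact fun y hy => mul i y hy
    | one => exact fun y hy => (one_mul y).symm ▸ hy
    | mul x₁ x₂ h₁ h₂ ih₁ ih₂ =>
      intro y hy
      have := ih₁ _ (ih₂ y hy)
      rwa [← mul_assoc] at this
  simpa using key w 1 one

theorem refl_reflectionPerm (γ β : ι) :
    refl P (refl P γ • β) = refl P γ * refl P β * refl P γ := by
  apply weylGroup_ext
  intro m
  rw [mul_smul, mul_smul]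
  simp only [refl_smul_weight, refl_smul]
  rw [reflection_reflectionPerm]
  rfl

theorem refl_smul_eq_conj (w : P.weylGroup) (β : ι) :
    refl P (w • β) = w * refl P β * w⁻¹ := by
  induction w using weylGroup_induction with
  | one => simp
  | mul γ w ih => rw [mul_smul, refl_reflectionPerm, ih, mul_inv_rev, refl_inv]; group

theorem mul_refl_eq (w : P.weylGroup) (β : ι) : w * refl P β = refl P (w • β) * w := by
  rw [refl_smul_eq_conj]; group

theorem refl_mul_eq (w : P.weylGroup) (β : ι) : refl P β * w = w * refl P (w⁻¹ • β) := by
  rw [mul_refl_eq, smul_inv_smul]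

/-- The index of the negative of a root. -/
def opp (P : RootPairing ι K M N) (i : ι) : ι := P.reflectionPerm i i

theorem root_opp (i : ι) : P.root (opp P i) = -P.root i := by
  simp [opp]

theorem refl_smul_self (i : ι) : refl P i • i = opp P i := rfl

theorem smul_opp (w : P.weylGroup) (i : ι) : w • opp P i = opp P (w • i) := by
  apply P.root.injective
  rw [root_smul, root_opp, root_opp, root_smul, smul_neg]

@[simp] theorem opp_opp (i : ι) : opp P (opp P i) = i := by
  apply P.root.injective
  rw [root_opp, root_opp, neg_neg]

@[simp] theorem refl_opp (i : ι) : refl P (opp P i) = refl P i := by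
  rw [← refl_smul_self, refl_reflectionPerm, refl_mul_self, one_mul]

theorem opp_ne (i : ι) : opp P i ≠ i := by
  have := P.ne_neg i
  intro h
  exact this h.symm

variable [P.IsCrystallographic]

theorem pairingIn_refl (γ i j : ι) :
    P.pairingIn ℤ (refl P γ • i) (refl P γ • j) = P.pairingIn ℤ i j := by
  rw [refl_smul, refl_smul, pairingIn_reflectionPerm, reflectionPerm_self]

theorem pairingIn_smul (w : P.weylGroup) (i j : ι) :
    P.pairingIn ℤ (w • i) (w • j) = P.pairingIn ℤ i j := by
  induction w using weylGroup_induction with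
  | one => simp
  | mul γ w ih => rw [mul_smul, mul_smul, pairingIn_refl, ih]

theorem pairingIn_opp_left (i j : ι) : P.pairingIn ℤ (opp P i) j = -P.pairingIn ℤ i j := by
  simp [opp]

theorem pairingIn_opp_right (i j : ι) : P.pairingIn ℤ i (opp P j) = -P.pairingIn ℤ i j := by
  simp [opp]

theorem root_refl_smul (β δ : ι) :
    P.root (refl P β • δ) = P.root δ + (-P.pairingIn ℤ δ β) • P.root β := by
  rw [refl_smul, root_reflectionPerm, reflection_apply_root' ℤ, neg_smul, sub_eq_add_neg]

theorem pairingIn_refl_left (β δ j : ι) : P.pairingIn ℤ (refl P β • δ) j =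
    P.pairingIn ℤ δ j - P.pairingIn ℤ δ β * P.pairingIn ℤ β j := by
  have h := pairingIn_eq_add_of_root_eq_smul_add_smul (P := P) (S := ℤ) (i := δ) (j := j) (k := refl P β • δ) (l := β)
    (x := 1) (y := -P.pairingIn ℤ δ β) (by rw [one_smul, root_refl_smul])
  rw [h]; simp; ring

theorem pairingIn_refl_right (β δ j : ι) : P.pairingIn ℤ j (refl P β • δ) =
    P.pairingIn ℤ j δ - P.pairingIn ℤ β δ * P.pairingIn ℤ j β := by
  rw [← pairingIn_refl β j, refl_smul_refl_smul, pairingIn_refl_left]; ring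

variable {b : P.Base}

theorem root_smul_refl_smul (w : P.weylGroup) (β δ : ι) :
    P.root (w • refl P β • δ) = P.root (w • δ) + (-P.pairingIn ℤ δ β) • P.root (w • β) := by
  rw [root_smul, root_refl_smul, smul_add, ← Int.cast_smul_eq_zsmul K, smul_comm w,
    Int.cast_smul_eq_zsmul, root_smul, root_smul]

theorem height_smul_refl_smul (w : P.weylGroup) (β δ : ι) :
    b.height (w • refl P β • δ) = b.height (w • δ) - P.pairingIn ℤ δ β * b.height (w • β) := by
  rw [b.height_add_zsmul (root_smul_refl_smul w β δ)]; simp; ring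

theorem height_refl_smul (β δ : ι) :
    b.height (refl P β • δ) = b.height δ - P.pairingIn ℤ δ β * b.height β := by
  simpa using height_smul_refl_smul (b := b) 1 β δ

theorem height_opp (i : ι) : b.height (opp P i) = -b.height i := b.height_reflectionPerm_self i

theorem isPos_opp {i : ι} : b.IsPos (opp P i) ↔ ¬ b.IsPos i := Base.IsPos.neg_iff_not b i

theorem not_isPos_iff {i : ι} : ¬ b.IsPos i ↔ b.height i < 0 := by
  rw [Base.isPos_iff]; have := b.height_ne_zero i; omega

variable [P.IsReduced]

/-! ### Words, length and the exchange property -/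

theorem isPos_refl_of_mem_support {i α : ι} (hi : b.IsPos i) (hα : α ∈ b.support) (h : i ≠ α) :
    b.IsPos (refl P α • i) := hi.reflectionPerm hα h

@[simp] theorem wordProd_nil : wordProd b [] = 1 := rfl

@[simp] theorem wordProd_cons (i : b.support) (l : List b.support) :
    wordProd b (i :: l) = refl P i * wordProd b l := by simp [wordProd]

theorem wordProd_append (l l' : List b.support) :
    wordProd b (l ++ l') = wordProd b l * wordProd b l' := by simp [wordProd]

theorem wordProd_reverse (l : List b.support) :
    wordProd b l.reverse = (wordProd b l)⁻¹ := by
  induction l with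
  | nil => simp
  | cons i l ih => simp [wordProd_append, ih]

theorem exists_wordProd_eq_refl (β : ι) : ∃ l, wordProd b l = refl P β := by
  induction β using b.induction_reflect with
  | h₀ i h => rw [← refl_smul, refl_smul_self, refl_opp]; exact h
  | h₁ i h => exact ⟨[⟨i, h⟩], by simp⟩
  | h₂ i j h hj =>
    obtain ⟨l, hl⟩ := h
    refine ⟨⟨j, hj⟩ :: (l ++ [⟨j, hj⟩]), ?_⟩
    rw [← refl_smul, refl_reflectionPerm, wordProd_cons, wordProd_append, hl]
    simp [mul_assoc]

theorem exists_wordProd_eq (w : P.weylGroup) : ∃ l, wordProd b l = w := by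
  induction w using weylGroup_induction with
  | one => exact ⟨[], rfl⟩
  | mul β w h =>
    obtain ⟨l, rfl⟩ := h
    obtain ⟨l', h'⟩ := exists_wordProd_eq_refl (b := b) β
    exact ⟨l' ++ l, by rw [wordProd_append, h']⟩

theorem len_wordProd_le (l : List b.support) : len b (wordProd b l) ≤ l.length :=
  Nat.sInf_le ⟨l, rfl, rfl⟩

theorem exists_isReducedWord (b : P.Base) (w : P.weylGroup) : ∃ l, IsReducedWord b l w := by
  have h : {n | ∃ l : List b.support, wordProd b l = w ∧ l.length = n}.Nonempty := by
    obtain ⟨l, hl⟩ := exists_wordProd_eq (b := b) w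
    exact ⟨_, l, hl, rfl⟩
  exact Nat.sInf_mem h

@[simp] theorem len_one : len b (1 : P.weylGroup) = 0 :=
  Nat.le_zero.mp (len_wordProd_le (b := b) [])

theorem len_mul_le (x y : P.weylGroup) : len b (x * y) ≤ len b x + len b y := by
  obtain ⟨l, hl, h⟩ := exists_isReducedWord b x
  obtain ⟨l', hl', h'⟩ := exists_isReducedWord b y
  rw [← h, ← h', ← hl, ← hl', ← wordProd_append, ← List.length_append]
  exact len_wordProd_le _

theorem len_inv (x : P.weylGroup) : len b x⁻¹ = len b x := by
  have key : ∀ x : P.weylGroup, len b x⁻¹ ≤ len b x := by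
    intro x
    obtain ⟨l, hl, h⟩ := exists_isReducedWord b x
    rw [← h, ← hl, ← wordProd_reverse, ← List.length_reverse]
    exact len_wordProd_le _
  exact le_antisymm (key x) (by simpa using key x⁻¹)

/-- Reading the word from the left, `β` is reflected by one letter after another and stays positive
until it equals the current simple root; that is the letter to delete. -/
theorem exchange (l : List b.support) {β : ι} (hβ : b.IsPos β)
    (h : ¬ b.IsPos ((wordProd b l)⁻¹ • β)) :
    ∃ l' : List b.support, l'.length + 1 = l.length ∧ wordProd b l' = refl P β * wordProd b l := by
  induction l generalizing β with
  | nil => simp [hβ] at h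
  | cons i l ih =>
    by_cases hi : β = i
    · exact ⟨l, rfl, by simp [hi]⟩
    · have h' := isPos_refl_of_mem_support hβ i.2 hi
      obtain ⟨l', hl', hw⟩ := ih h' (by simpa [mul_smul] using h)
      refine ⟨i :: l', by simpa using hl', ?_⟩
      rw [wordProd_cons, hw, refl_reflectionPerm, wordProd_cons]
      simp [← mul_assoc]

theorem len_refl_mul_lt {w : P.weylGroup} {β : ι} (hβ : b.IsPos β) (h : ¬ b.IsPos (w⁻¹ • β)) :
    len b (refl P β * w) < len b w := by
  obtain ⟨l, rfl, hl⟩ := exists_isReducedWord b w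
  obtain ⟨l', hl', h'⟩ := exchange l hβ h
  rw [← h', ← hl, ← hl']
  exact Nat.lt_succ_of_le (len_wordProd_le l')

theorem len_mul_refl_lt {w : P.weylGroup} {β : ι} (hβ : b.IsPos β) (h : ¬ b.IsPos (w • β)) :
    len b (w * refl P β) < len b w := by
  rw [← len_inv (x := w), ← len_inv, mul_inv_rev, refl_inv]
  exact len_refl_mul_lt hβ (by simpa using h)

theorem isPos_mul_refl_smul {w : P.weylGroup} {β : ι} :
    b.IsPos ((w * refl P β) • β) ↔ ¬ b.IsPos (w • β) := by
  rw [mul_smul, refl_smul_self, smul_opp, isPos_opp]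

theorem lt_len_mul_refl {w : P.weylGroup} {β : ι} (hβ : b.IsPos β) (h : b.IsPos (w • β)) :
    len b w < len b (w * refl P β) := by
  simpa using len_mul_refl_lt (w := w * refl P β) hβ (by simpa [isPos_mul_refl_smul] using h)

theorem len_refl_le_one {α : ι} (hα : α ∈ b.support) : len b (refl P α) ≤ 1 := by
  simpa using len_wordProd_le (b := b) [⟨α, hα⟩]

theorem len_simple_mul_of_not_isPos {α : ι} (hα : α ∈ b.support) {w : P.weylGroup}
    (h : ¬ b.IsPos (w⁻¹ • α)) : len b (refl P α * w) + 1 = len b w := by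
  have h1 := len_refl_mul_lt (b.isPos_of_mem_support hα) h
  have h2 := len_mul_le (b := b) (refl P α) (refl P α * w)
  have h3 := len_refl_le_one hα
  rw [refl_mul_refl_mul] at h2
  omega

theorem isPos_refl_mul_inv_smul {w : P.weylGroup} {β : ι} :
    b.IsPos ((refl P β * w)⁻¹ • β) ↔ ¬ b.IsPos (w⁻¹ • β) := by
  rw [mul_inv_rev, refl_inv, mul_smul, refl_smul_self, smul_opp, isPos_opp]

theorem len_simple_mul_of_isPos {α : ι} (hα : α ∈ b.support) {w : P.weylGroup}
    (h : b.IsPos (w⁻¹ • α)) : len b (refl P α * w) = len b w + 1 := by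
  simpa using (len_simple_mul_of_not_isPos (w := refl P α * w) hα
    (by rw [isPos_refl_mul_inv_smul, not_not]; exact h)).symm

/-! ### Length as the number of inversions -/

open Classical in
/-- The set of inversions of `w`: the positive roots sent to negative roots by `w`. -/
noncomputable def inversions (b : P.Base) (w : P.weylGroup) : Finset ι :=
  {β : ι | b.IsPos β ∧ ¬ b.IsPos (w • β)}

theorem mem_inversions {w : P.weylGroup} {β : ι} :
    β ∈ inversions b w ↔ b.IsPos β ∧ ¬ b.IsPos (w • β) := by simp [inversions]

theorem inversions_simple_mul [DecidableEq ι] {α : ι} (hα : α ∈ b.support) {y : P.weylGroup}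
    (hpos : b.IsPos (y⁻¹ • α)) :
    inversions b (refl P α * y) = insert (y⁻¹ • α) (inversions b y) := by
  ext γ
  simp only [mem_inversions, Finset.mem_insert]
  have hγ : y • γ = α ↔ γ = y⁻¹ • α := by rw [eq_inv_smul_iff]
  have hγ' : y • γ = opp P α → ¬ b.IsPos γ := by
    intro h
    rw [← isPos_opp, ← inv_smul_smul y γ, ← smul_opp, h, opp_opp]; exact hpos
  rw [mul_smul]
  by_cases h5 : γ = y⁻¹ • α
  · subst h5
    simp [hpos, refl_smul_self, isPos_opp, b.isPos_of_mem_support hα]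
  · simp only [h5, false_or]
    refine and_congr_right fun hp => not_congr ⟨fun h => ?_, fun h => ?_⟩
    · by_cases h6 : refl P α • y • γ = α
      · refine absurd hp (hγ' ?_)
        rw [← refl_smul_self, ← refl_smul_refl_smul (P := P) α (y • γ), h6]
      · simpa using isPos_refl_of_mem_support h hα h6
    · exact isPos_refl_of_mem_support h hα (by rwa [Ne, hγ])

theorem card_inversions (w : P.weylGroup) : (inversions b w).card = len b w := by
  classical
  generalize hn : len b w = n
  induction n generalizing w with
  | zero =>
    rw [Finset.card_eq_zero, Finset.eq_empty_iff_forall_notMem]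
    intro β hβ
    rw [mem_inversions] at hβ
    exact absurd (len_mul_refl_lt hβ.1 hβ.2) (by omega)
  | succ n ih =>
    obtain ⟨l, rfl, hl⟩ := exists_isReducedWord b w
    obtain - | ⟨i, l⟩ := l
    · simp at hn
    rw [wordProd_cons] at hn hl ⊢
    set y := wordProd b l with hy
    have h1 : len b y ≤ l.length := len_wordProd_le l
    have h2 := len_mul_le (b := b) (refl P i) y
    have h3 := len_refl_le_one i.2
    have h4 : len b y = n := by rw [List.length_cons] at hl; omega
    have hpos : b.IsPos (y⁻¹ • (i : ι)) := by
      by_contra h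
      have := len_simple_mul_of_not_isPos i.2 h
      omega
    rw [inversions_simple_mul i.2 hpos, Finset.card_insert_of_notMem, ih y h4]
    simp [mem_inversions, b.isPos_of_mem_support i.2]

/-! ### Length bounds through `⟨2ρ, β^∨⟩`, and the two kinds of edges -/

theorem twoRho_refl_smul (β ε : ι) :
    twoRho b (refl P β • ε) = twoRho b ε - P.pairingIn ℤ β ε * twoRho b β := by
  simp only [twoRho, pairingIn_refl_right, Finset.sum_sub_distrib, Finset.mul_sum]

theorem twoRho_opp (β : ι) : twoRho b (opp P β) = -twoRho b β := by
  simp only [twoRho, pairingIn_opp_right, Finset.sum_neg_distrib]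

theorem pairingIn_pos_of_mem_inversions_refl {β γ : ι} (hβ : b.IsPos β)
    (hγ : γ ∈ inversions b (refl P β)) : 0 < P.pairingIn ℤ γ β := by
  rw [mem_inversions, not_isPos_iff, height_refl_smul, Base.isPos_iff] at hγ
  rw [Base.isPos_iff] at hβ
  by_contra h
  nlinarith

/-- The positive roots that `s_β` keeps positive are permuted by `s_β`, which negates the pairing
with `β^∨`, so they contribute nothing. -/
theorem twoRho_eq_sum_inversions (β : ι) :
    twoRho b β = ∑ γ ∈ inversions b (refl P β), P.pairingIn ℤ γ β := by
  classical
  have hsub : inversions b (refl P β) ⊆ ({α : ι | b.IsPos α} : Finset ι) := by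
    intro γ hγ
    simpa using (mem_inversions.mp hγ).1
  have h0 : ∑ γ ∈ ({α : ι | b.IsPos α} : Finset ι) \ inversions b (refl P β),
      P.pairingIn ℤ γ β = 0 := by
    have mem : ∀ γ, γ ∈ ({α : ι | b.IsPos α} : Finset ι) \ inversions b (refl P β) ↔
        b.IsPos γ ∧ b.IsPos (refl P β • γ) := by
      intro γ
      simp only [Finset.mem_sdiff, Finset.mem_filter, Finset.mem_univ, true_and, mem_inversions]
      tauto
    have hneg : ∀ γ, P.pairingIn ℤ (refl P β • γ) β = -P.pairingIn ℤ γ β := by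
      intro γ
      rw [pairingIn_refl_left, pairingIn_same]; ring
    refine Finset.sum_involution (fun γ _ => refl P β • γ) ?_ ?_ ?_ ?_
    · intro γ _; rw [hneg]; ring
    · intro γ _ h1 h2
      have := hneg γ
      rw [h2] at this
      omega
    · intro γ h
      rw [mem] at h ⊢
      exact ⟨h.2, by simpa using h.1⟩
    · intro γ _; simp
  simp only [twoRho]
  rw [← Finset.sum_sdiff hsub, h0, zero_add]

/-- Each inversion of `s_β` contributes at least 1 to the sum, and `β` itself contributes 2. -/
theorem len_refl_lt_twoRho {β : ι} (hβ : b.IsPos β) :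
    (len b (refl P β) : ℤ) + 1 ≤ twoRho b β := by
  classical
  have hmem : β ∈ inversions b (refl P β) := by
    rw [mem_inversions, refl_smul_self, isPos_opp]; tauto
  rw [twoRho_eq_sum_inversions, ← card_inversions, ← Finset.add_sum_erase _ _ hmem, pairingIn_same,
    ← Finset.card_erase_add_one hmem]
  have : ∑ γ ∈ (inversions b (refl P β)).erase β, (1 : ℤ) ≤
      ∑ γ ∈ (inversions b (refl P β)).erase β, P.pairingIn ℤ γ β :=
    Finset.sum_le_sum fun γ hγ =>
      pairingIn_pos_of_mem_inversions_refl hβ (Finset.mem_of_mem_erase hγ)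
  simp only [Finset.sum_const, nsmul_eq_mul, mul_one] at this
  push_cast
  linarith

theorem len_mul_refl_ge {β : ι} (hβ : b.IsPos β) (u : P.weylGroup) :
    (len b u : ℤ) + 1 - twoRho b β ≤ len b (u * refl P β) := by
  have h1 := len_refl_lt_twoRho hβ
  have h2 := len_mul_le (b := b) (u * refl P β) (refl P β)
  rw [mul_refl_mul_refl] at h2
  omega

theorem two_le_twoRho {β : ι} (hβ : b.IsPos β) : 2 ≤ twoRho b β := by
  have h1 := len_refl_lt_twoRho hβ
  have h2 := len_mul_refl_lt (w := refl P β) hβ (by rw [refl_smul_self, isPos_opp]; tauto)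
  omega

/-- The sign of `uβ` decides the kind of edge: it fixes whether the length grows, and a quantum edge
always lowers it because `⟨2ρ, β^∨⟩ ≥ 2`. -/
theorem IsEdge.len_of_isPos {u v : P.weylGroup} {β : ι} (h : IsEdge b u β v)
    (hp : b.IsPos (u • β)) : len b v = len b u + 1 := by
  obtain ⟨hβ, rfl, h⟩ := h
  have := lt_len_mul_refl hβ hp
  have := two_le_twoRho hβ
  omega

theorem IsEdge.len_of_not_isPos {u v : P.weylGroup} {β : ι} (h : IsEdge b u β v)
    (hp : ¬ b.IsPos (u • β)) : (len b v : ℤ) = len b u + 1 - twoRho b β := by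
  obtain ⟨hβ, rfl, h⟩ := h
  have := len_mul_refl_lt hβ hp
  omega

/-! ### Affine simple roots: simple roots and negatives of highest roots -/

/-- Roots `a`, such as the simple roots and the negatives of highest roots, for which left
multiplication by the reflection `s_a` is compatible with the edges of the quantum Bruhat graph. -/
structure IsAffineSimple (b : P.Base) (a : ι) : Prop where
  edge : ∀ x : P.weylGroup, b.IsPos (x⁻¹ • a) → IsEdge b x (x⁻¹ • a) (refl P a * x)
  lift : ∀ (x : P.weylGroup) (β : ι) (y : P.weylGroup), IsEdge b x β y →
    (b.IsPos (x⁻¹ • a) ↔ b.IsPos (y⁻¹ • a)) → IsEdge b (refl P a * x) β (refl P a * y)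
  cross : ∀ (x : P.weylGroup) (β : ι) (y : P.weylGroup), IsEdge b x β y →
    b.IsPos (x⁻¹ • a) → ¬ b.IsPos (y⁻¹ • a) → β = x⁻¹ • a

/-- On one side of `α`, `s_α` shifts all lengths by the same amount, so edges survive. If a crossing
edge had another label than `x⁻¹α`, its reflection would violate either the growth of length along a
positive `xβ` or the bound `len_mul_refl_ge`. -/
theorem isAffineSimple_of_mem_support {α : ι} (hα : α ∈ b.support) : IsAffineSimple b α where
  edge x hx := ⟨hx, refl_mul_eq x α, Or.inl (by
    exact_mod_cast len_simple_mul_of_isPos hα hx)⟩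
  lift x β y h hxy := by
    refine ⟨h.1, by rw [h.2.1, mul_assoc], ?_⟩
    by_cases hx : b.IsPos (x⁻¹ • α)
    · rw [len_simple_mul_of_isPos hα hx, len_simple_mul_of_isPos hα (hxy.mp hx)]
      have := h.2.2
      push_cast
      omega
    · have h1 := len_simple_mul_of_not_isPos hα hx
      have h2 := len_simple_mul_of_not_isPos hα (hxy.not.mp hx)
      have := h.2.2
      omega
  cross x β y h hx hy := by
    by_contra hne
    have h1 := len_simple_mul_of_isPos hα hx
    have h2 := len_simple_mul_of_not_isPos hα hy
    have h3 : refl P α * y = refl P α * x * refl P β := by rw [h.2.1, mul_assoc]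
    by_cases hp : b.IsPos (x • β)
    · have h4 := h.len_of_isPos hp
      have h5 : b.IsPos ((refl P α * x) • β) := by
        rw [mul_smul]
        exact isPos_refl_of_mem_support hp hα (by rwa [Ne, ← eq_inv_smul_iff])
      have h6 := lt_len_mul_refl h.1 h5
      rw [← h3] at h6
      omega
    · have h4 := h.len_of_not_isPos hp
      have h5 := len_mul_refl_ge h.1 (refl P α * x)
      rw [← h3] at h5
      omega

/-- The positive root `θ` satisfies `⟨γ, θ^∨⟩ ∈ {0, 1}` for all positive roots `γ ≠ θ`. -/
def IsHighest (b : P.Base) (θ : ι) : Prop :=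
  b.IsPos θ ∧ ∀ γ, b.IsPos γ → γ ≠ θ → P.pairingIn ℤ γ θ = 0 ∨ P.pairingIn ℤ γ θ = 1

theorem IsHighest.pairingIn_cases {θ : ι} (hθ : IsHighest b θ) (γ : ι) :
    γ = θ ∨ γ = opp P θ ∨ P.pairingIn ℤ γ θ = 0 ∨ (P.pairingIn ℤ γ θ = 1 ∧ b.IsPos γ) ∨
      (P.pairingIn ℤ γ θ = -1 ∧ ¬ b.IsPos γ) := by
  by_cases hγ : b.IsPos γ
  · by_cases h : γ = θ
    · exact Or.inl h
    · have := hθ.2 γ hγ h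
      tauto
  · by_cases h : opp P γ = θ
    · exact Or.inr (Or.inl (by rw [← h, opp_opp]))
    · have := hθ.2 _ (isPos_opp.mpr hγ) h
      rw [pairingIn_opp_left] at this
      have : P.pairingIn ℤ γ θ = 0 ∨ P.pairingIn ℤ γ θ = -1 := by omega
      tauto

theorem refl_smul_eq_self {θ γ : ι} (h : P.pairingIn ℤ γ θ = 0) : refl P θ • γ = γ := by
  apply P.root.injective
  rw [root_refl_smul, h]; simp

open Classical in
theorem IsHighest.sign_refl {θ : ι} (hθ : IsHighest b θ) (γ : ι) :
    (if b.IsPos (refl P θ • γ) then (0 : ℤ) else 1) = (if b.IsPos γ then 0 else 1) +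
      P.pairingIn ℤ γ θ - (if γ = θ then 1 else 0) + (if γ = opp P θ then 1 else 0) := by
  have hpair : P.pairingIn ℤ (refl P θ • γ) θ = -P.pairingIn ℤ γ θ := by
    rw [pairingIn_refl_left, pairingIn_same]; ring
  have hne := opp_ne (P := P) θ
  have hc := hθ.pairingIn_cases (refl P θ • γ)
  rcases hθ.pairingIn_cases γ with rfl | rfl | h | ⟨h, hp⟩ | ⟨h, hp⟩
  · simp [refl_smul_self, isPos_opp, hθ.1, hne.symm]
  · simp [smul_opp, refl_smul_self, isPos_opp, hθ.1, hne, pairingIn_opp_left]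
  · have h1 : γ ≠ θ := by rintro rfl; simp at h
    have h2 : γ ≠ opp P θ := by rintro rfl; simp [pairingIn_opp_left] at h
    simp [refl_smul_eq_self h, h, h1, h2]
  · have h1 : γ ≠ θ := by rintro rfl; simp at h
    have h2 : γ ≠ opp P θ := by rintro rfl; simp [pairingIn_opp_left] at h
    have h3 : ¬ b.IsPos (refl P θ • γ) := by
      rw [hpair, h] at hc
      rcases hc with hc | hc | hc | hc | hc
      · simp [hc, h] at hpair
      · simp [hc, h, pairingIn_opp_left] at hpair
      · omega
      · omega
      · exact hc.2
    simp [h, h1, h2, h3, hp]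
  · have h1 : γ ≠ θ := by rintro rfl; simp at h
    have h2 : γ ≠ opp P θ := by rintro rfl; simp [pairingIn_opp_left] at h
    have h3 : b.IsPos (refl P θ • γ) := by
      rw [hpair, h] at hc
      rcases hc with hc | hc | hc | hc | hc
      · simp [hc, h] at hpair
      · simp [hc, h, pairingIn_opp_left] at hpair
      · omega
      · exact hc.2
      · omega
    simp [h, h1, h2, h3, hp]

open Classical in
theorem len_eq_sum (x : P.weylGroup) :
    (len b x : ℤ) = ∑ γ : ι with b.IsPos γ, if b.IsPos (x • γ) then 0 else 1 := by
  rw [← card_inversions, Finset.card_eq_sum_ones]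
  push_cast
  rw [inversions, ← Finset.filter_filter, Finset.sum_filter]
  exact Finset.sum_congr rfl fun γ _ => by split_ifs <;> simp_all

-- By `sign_refl`, `s_θ` changes the sign indicator of a root by its pairing with `θ^∨`, up to
-- corrections at `±θ`. Summing over `xγ` for positive `γ` turns the pairings into `⟨2ρ, (x⁻¹θ)^∨⟩`.
open Classical in
theorem IsHighest.len_refl_mul {θ : ι} (hθ : IsHighest b θ) (x : P.weylGroup) :
    (len b (refl P θ * x) : ℤ) =
      len b x + twoRho b (x⁻¹ • θ) + (if b.IsPos (x⁻¹ • θ) then -1 else 1) := by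
  have h1 : ∀ γ, P.pairingIn ℤ (x • γ) θ = P.pairingIn ℤ γ (x⁻¹ • θ) := fun γ => by
    rw [← pairingIn_smul x γ, smul_inv_smul]
  have h2 : ∀ γ, x • γ = θ ↔ γ = x⁻¹ • θ := fun γ => eq_inv_smul_iff.symm
  have h3 : ∀ γ, x • γ = opp P θ ↔ γ = opp P (x⁻¹ • θ) := fun γ => by
    rw [← smul_opp, eq_inv_smul_iff]
  rw [len_eq_sum, len_eq_sum]
  simp only [mul_smul, hθ.sign_refl, Finset.sum_add_distrib, Finset.sum_sub_distrib, h1, h2, h3,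
    Finset.sum_ite_eq', Finset.mem_filter, Finset.mem_univ, true_and, isPos_opp, twoRho]
  split_ifs <;> ring

/-- The kind of the reflected edge depends on `⟨xβ, θ^∨⟩`: for 0 it is unchanged, for 1 a Bruhat
edge becomes quantum, for -1 a quantum edge becomes Bruhat. The values `±2` occur only for `xβ =
±θ`, where the edge crosses. -/
theorem isAffineSimple_opp_of_isHighest {θ : ι} (hθ : IsHighest b θ) :
    IsAffineSimple b (opp P θ) := by
  have hy : ∀ (x : P.weylGroup) (β : ι),
      (x * refl P β)⁻¹ • θ = refl P β • x⁻¹ • θ := fun x β => by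
    rw [mul_inv_rev, refl_inv, mul_smul]
  have hm : ∀ (x : P.weylGroup) (β : ι),
      P.pairingIn ℤ β (x⁻¹ • θ) = P.pairingIn ℤ (x • β) θ := fun x β => by
    rw [← pairingIn_smul x β, smul_inv_smul]
  constructor
  · intro x hx
    refine ⟨hx, by rw [refl_mul_eq], Or.inr ?_⟩
    rw [refl_opp, hθ.len_refl_mul]
    rw [smul_opp, isPos_opp] at hx
    rw [if_neg hx, smul_opp, twoRho_opp]
    ring
  · rintro x β y h hxy
    have h3 : refl P (opp P θ) * y = refl P (opp P θ) * x * refl P β := by rw [h.2.1, mul_assoc]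
    refine ⟨h.1, h3, ?_⟩
    rw [smul_opp, smul_opp, isPos_opp, isPos_opp, not_iff_not] at hxy
    obtain ⟨s, hlx, hly⟩ : ∃ s : ℤ,
        (len b (refl P θ * x) : ℤ) = len b x + twoRho b (x⁻¹ • θ) + s ∧
        (len b (refl P θ * y) : ℤ) = len b y + twoRho b (y⁻¹ • θ) + s := by
      refine ⟨_, hθ.len_refl_mul x, ?_⟩
      rw [hθ.len_refl_mul y]
      by_cases hp : b.IsPos (x⁻¹ • θ)
      · rw [if_pos hp, if_pos (hxy.mp hp)]
      · rw [if_neg hp, if_neg (mt hxy.mpr hp)]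
    have hedge := h.2.2
    have ht : twoRho b (y⁻¹ • θ) =
        twoRho b (x⁻¹ • θ) - P.pairingIn ℤ (x • β) θ * twoRho b β := by
      rw [h.2.1, hy, twoRho_refl_smul, hm]
    rw [refl_opp]
    rcases hθ.pairingIn_cases (x • β) with h4 | h4 | h4 | ⟨h4, hp⟩ | ⟨h4, hp⟩
    · have : β = x⁻¹ • θ := eq_inv_smul_iff.mpr h4
      rw [h.2.1, hy, ← this, refl_smul_self, isPos_opp] at hxy
      tauto
    · have : x⁻¹ • θ = opp P β := by rw [eq_comm, eq_inv_smul_iff, smul_opp, h4, opp_opp]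
      rw [h.2.1, hy, this, smul_opp, refl_smul_self, opp_opp, isPos_opp] at hxy
      tauto
    · rw [h4] at ht
      omega
    · have := h.len_of_isPos hp
      rw [h4] at ht
      right; omega
    · have := h.len_of_not_isPos hp
      rw [h4] at ht
      left; omega
  · intro x β y h hxp hyn
    by_contra hne
    rw [smul_opp, isPos_opp] at hxp hyn
    rw [not_not] at hyn
    have hlx := hθ.len_refl_mul x
    have hly := hθ.len_refl_mul y
    rw [if_neg hxp] at hlx
    rw [if_pos hyn] at hly
    have ht : twoRho b (y⁻¹ • θ) =
        twoRho b (x⁻¹ • θ) - P.pairingIn ℤ (x • β) θ * twoRho b β := by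
      rw [h.2.1, hy, twoRho_refl_smul, hm]
    have hneg : P.pairingIn ℤ (x • β) θ < 0 := by
      rw [← hm]
      rw [h.2.1, hy, Base.isPos_iff, height_refl_smul] at hyn
      rw [not_isPos_iff] at hxp
      have hβ := h.1
      rw [Base.isPos_iff] at hβ
      rw [P.pairingIn_lt_zero_iff]
      by_contra h'
      nlinarith
    rcases hθ.pairingIn_cases (x • β) with h4 | h4 | h4 | ⟨h4, hp⟩ | ⟨h4, hp⟩
    · rw [h4] at hneg; simp at hneg
    · exact hne (eq_inv_smul_iff.mpr h4)
    · omega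
    · omega
    · have h5 := h.len_of_not_isPos hp
      rw [h4] at ht
      have h6 : b.IsPos ((refl P θ * x) • β) := by
        have h7 := hθ.sign_refl (x • β)
        rw [mul_smul]
        by_contra h8
        have h1 : x • β ≠ θ := by intro h9; rw [h9] at h4; simp at h4
        have h2 : x • β ≠ opp P θ := by
          intro h9; rw [h9, pairingIn_opp_left] at h4; simp at h4
        simp [h8, hp, h4, h1, h2] at h7
      have h7 := lt_len_mul_refl h.1 h6
      rw [mul_assoc, ← h.2.1] at h7
      omega

/-! ### Linearity of height and existence of highest roots -/

theorem height_eq_sum_mul {s : Finset ι} {f : ι → ℤ} {g : ι → ι} {k : ι}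
    (h : P.root k = ∑ j ∈ s, f j • P.root (g j)) :
    b.height k = ∑ j ∈ s, f j * b.height (g j) := by
  choose F _ _ hF using b.exists_root_eq_sum_int
  have hk : P.root k = ∑ i ∈ b.support, (∑ j ∈ s, f j * F (g j) i) • P.root i := by
    rw [h]
    simp only [Finset.sum_smul]
    rw [Finset.sum_comm]
    refine Finset.sum_congr rfl fun j _ => ?_
    conv_lhs => rw [hF (g j)]
    rw [Finset.smul_sum]
    simp only [mul_smul]
  rw [Base.height_eq_sum hk, Finset.sum_comm]
  refine Finset.sum_congr rfl fun j _ => ?_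
  rw [Base.height_eq_sum (hF (g j)), Finset.mul_sum]

theorem height_smul_eq_sum_mul {s : Finset ι} {f : ι → ℤ} {k : ι}
    (h : P.root k = ∑ j ∈ s, f j • P.root j) (w : P.weylGroup) :
    b.height (w • k) = ∑ j ∈ s, f j * b.height (w • j) := by
  refine height_eq_sum_mul ?_
  rw [root_smul, h, Finset.smul_sum]
  refine Finset.sum_congr rfl fun j _ => ?_
  rw [← Int.cast_smul_eq_zsmul K, smul_comm w, Int.cast_smul_eq_zsmul, root_smul]

theorem exists_root_eq_sum_of_isPos {γ : ι} (hγ : b.IsPos γ) :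
    ∃ f : ι → ℤ, 0 ≤ f ∧ P.root γ = ∑ j ∈ b.support, f j • P.root j := by
  obtain ⟨f, _, hf | hf, h⟩ := b.exists_root_eq_sum_int γ
  · exact ⟨f, hf.le, h⟩
  · rw [Base.isPos_iff, Base.height_eq_sum h] at hγ
    exact absurd (Finset.sum_nonpos fun j _ => hf.le j) hγ.not_ge

/-- A root of maximal height among those involving `α` works: no positive root can be added to it.
Requiring only `0 < f α` avoids any irreducibility assumption. -/
theorem exists_isHighest {α : ι} (hα : α ∈ b.support) :
    ∃ (θ : ι) (f : ι → ℤ), IsHighest b θ ∧ P.root θ = ∑ j ∈ b.support, f j • P.root j ∧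
      0 ≤ f ∧ 0 < f α := by
  classical
  let S : Set ι := {γ | ∃ f : ι → ℤ, P.root γ = ∑ j ∈ b.support, f j • P.root j ∧ 0 ≤ f ∧ 0 < f α}
  have hSpos : ∀ γ ∈ S, b.IsPos γ := by
    rintro γ ⟨f, h, hf, -⟩
    rw [Base.isPos_iff', Base.height_eq_sum h]
    exact Finset.sum_nonneg fun j _ => hf j
  have hSadd : ∀ γ ∈ S, ∀ δ, b.IsPos δ → ∀ k, P.root k = P.root γ + P.root δ → k ∈ S := by
    rintro γ ⟨f, h, hf, hf'⟩ δ hδ k hk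
    obtain ⟨g, hg, hgδ⟩ := exists_root_eq_sum_of_isPos hδ
    refine ⟨f + g, ?_, add_nonneg hf hg, add_pos_of_pos_of_nonneg hf' (hg α)⟩
    rw [hk, h, hgδ, ← Finset.sum_add_distrib]
    simp only [Pi.add_apply, add_smul]
  have hSα : α ∈ S := by
    refine ⟨Pi.single α 1, ?_, ?_, by simp⟩
    · rw [Finset.sum_eq_single_of_mem α hα (by intro j _ hj; simp [hj])]
      simp
    · intro j
      by_cases hj : j = α
      · subst hj; simp
      · simp [hj]
  obtain ⟨θ, hθS, hmax⟩ := S.toFinite.exists_maximalFor b.height S ⟨α, hSα⟩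
  replace hmax : ∀ k δ, b.IsPos δ → P.root k ≠ P.root θ + P.root δ := by
    intro k δ hδ hk
    have h1 := hmax (hSadd θ hθS δ hδ k hk)
    rw [Base.isPos_iff] at hδ
    rw [b.height_add hk] at h1
    exact absurd (h1 (by omega)) (by omega)
  have hθ := hSpos θ hθS
  have hdom : ∀ γ, b.IsPos γ → 0 ≤ P.pairingIn ℤ γ θ := by
    intro γ hγ
    by_contra h
    rw [not_le] at h
    have hne : P.root γ ≠ -P.root θ := by
      rw [← root_opp]
      intro h'
      rw [P.root.injective h', isPos_opp] at hγ
      exact hγ hθ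
    obtain ⟨k, hk⟩ := P.root_add_root_mem_of_pairingIn_neg h hne
    exact hmax k γ hγ (by rw [hk, add_comm])
  obtain ⟨f, hf⟩ := hθS
  refine ⟨θ, f, ⟨hθ, fun γ hγ hne => ?_⟩, hf⟩
  by_contra! hpair
  have h0 := hdom γ hγ
  have h2 : 2 ≤ P.pairingIn ℤ γ θ := by omega
  obtain ⟨k, hk⟩ := P.root_sub_root_mem_of_pairingIn_pos (show 0 < P.pairingIn ℤ γ θ by omega) hne
  by_cases hkp : b.IsPos k
  · exact hmax γ k hkp (by rw [hk]; abel)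
  · have hkp' := isPos_opp.mpr hkp
    have h3 := hdom _ hkp'
    have h4 : P.pairingIn ℤ k θ = P.pairingIn ℤ γ θ - 2 := by
      have : P.root γ = P.root k + P.root θ := by rw [hk]; abel
      rw [P.pairingIn_eq_add_of_root_eq_add this, pairingIn_same]; ring
    rw [pairingIn_opp_left] at h3
    -- Here the pairing is exactly 2, and `-s_θ γ = 2θ - γ = θ + (θ - γ)` is a root obtained from
    -- `θ` by adding a positive root.
    refine hmax (opp P (refl P θ • γ)) _ hkp' ?_
    rw [root_opp, root_opp, root_refl_smul, hk, show P.pairingIn ℤ γ θ = 2 by omega]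
    module

theorem finite_weylGroup (b : P.Base) : Finite P.weylGroup := by
  have h : Set.Finite {l : List b.support | l.length ≤ Fintype.card ι} :=
    List.finite_length_le _ _
  refine Set.finite_univ_iff.mp ((h.image (wordProd b)).subset fun w _ => ?_)
  obtain ⟨l, hl, hl'⟩ := exists_isReducedWord b w
  refine ⟨l, ?_, hl⟩
  rw [Set.mem_ofPred_eq, hl', ← card_inversions]
  exact Finset.card_le_univ _

/-! ### The flow argument and the induction principle -/

section Flow

variable {U : Finset P.weylGroup} {a : ι}

/-- The terms at `u` and `s_a u` are opposite, so only those `u` whose partner lies outside `U`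
survive. -/
theorem sum_height_eq_sum_filter [DecidableEq P.weylGroup] :
    ∑ u ∈ U, b.height (u⁻¹ • a) = ∑ u ∈ U with refl P a * u ∉ U, b.height (u⁻¹ • a) := by
  rw [← Finset.sum_filter_add_sum_filter_not U (fun u => refl P a * u ∈ U)]
  rw [add_eq_right]
  refine Finset.sum_involution (fun u _ => refl P a * u) ?_ ?_ ?_ ?_
  · intro u _
    rw [mul_inv_rev, refl_inv, mul_smul, refl_smul_self, smul_opp, height_opp]; ring
  · intro u _ h1 h2
    have h3 : b.height ((refl P a * u)⁻¹ • a) = -b.height (u⁻¹ • a) := by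
      rw [mul_inv_rev, refl_inv, mul_smul, refl_smul_self, smul_opp, height_opp]
    rw [h2] at h3
    omega
  · intro u hu
    rw [Finset.mem_filter] at hu ⊢
    exact ⟨hu.2, by simpa using hu.1⟩
  · intro u _; simp

theorem sum_height_nonpos (hU : ∀ u ∈ U, b.IsPos (u⁻¹ • a) → refl P a * u ∈ U) :
    ∑ u ∈ U, b.height (u⁻¹ • a) ≤ 0 := by
  classical
  rw [sum_height_eq_sum_filter]
  refine Finset.sum_nonpos fun u hu => ?_
  rw [Finset.mem_filter] at hu
  exact not_lt.mp fun h => hu.2 (hU u hu.1 h)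

theorem refl_mul_mem_of_sum_height_eq_zero
    (hU : ∀ u ∈ U, b.IsPos (u⁻¹ • a) → refl P a * u ∈ U)
    (h0 : ∑ u ∈ U, b.height (u⁻¹ • a) = 0) : ∀ u ∈ U, refl P a * u ∈ U := by
  classical
  rw [sum_height_eq_sum_filter, Finset.sum_eq_zero_iff_of_nonpos] at h0
  · intro u hu
    by_contra h
    exact b.height_ne_zero _ (h0 u (Finset.mem_filter.mpr ⟨hu, h⟩))
  · intro u hu
    rw [Finset.mem_filter] at hu
    exact not_lt.mp fun h => hu.2 (hU u hu.1 h)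

/-- Let `S_a` be the sum of the heights of `u⁻¹a` over `U`. All `S_j` with `j` simple are
nonpositive, and so is `S_{-θ} = -∑ f_j S_j`; hence every `f_j S_j` vanishes. Since `f α > 0`, also
`S_α = 0`, which leaves no `u` without its partner. -/
theorem refl_mul_mem_of_closed
    (hU : ∀ a, IsAffineSimple b a → ∀ u ∈ U, b.IsPos (u⁻¹ • a) → refl P a * u ∈ U)
    {α : ι} (hα : α ∈ b.support) : ∀ u ∈ U, refl P α * u ∈ U := by
  refine refl_mul_mem_of_sum_height_eq_zero (hU α (isAffineSimple_of_mem_support hα)) ?_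
  obtain ⟨θ, f, hθ, hsum, hf, hfα⟩ := exists_isHighest hα
  have h1 := sum_height_nonpos (hU _ (isAffineSimple_opp_of_isHighest hθ))
  simp only [smul_opp, height_opp, Finset.sum_neg_distrib, height_smul_eq_sum_mul hsum] at h1
  rw [Finset.sum_comm] at h1
  simp only [← Finset.mul_sum] at h1
  have h2 : ∀ j ∈ b.support, f j * ∑ u ∈ U, b.height (u⁻¹ • j) ≤ 0 := fun j hj =>
    mul_nonpos_of_nonneg_of_nonpos (hf j)
      (sum_height_nonpos (hU j (isAffineSimple_of_mem_support hj)))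
  have h3 := (Finset.sum_eq_zero_iff_of_nonpos h2).mp
    (le_antisymm (Finset.sum_nonpos h2) (by omega)) α hα
  rcases mul_eq_zero.mp h3 with h | h
  · exact absurd h hfα.ne'
  · exact h

end Flow

/-- Induction on `ℓ(u⁻¹v)`. Crossing moves shorten `u⁻¹v`; lifting moves keep it, so for these
termination is not visible and comes from the flow argument applied to the set of bad starting
points. -/
theorem tilted_induction {T : P.weylGroup → P.weylGroup → Prop} (self : ∀ u, T u u)
    (cross : ∀ a, IsAffineSimple b a → ∀ u v, b.IsPos (u⁻¹ • a) → ¬ b.IsPos (v⁻¹ • a) →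
      T u (refl P a * v) → T (refl P a * u) v → T u v)
    (lift : ∀ a, IsAffineSimple b a → ∀ u v, b.IsPos (u⁻¹ • a) → b.IsPos (v⁻¹ • a) →
      T (refl P a * u) (refl P a * v) → T u v) (u v : P.weylGroup) : T u v := by
  classical
  have := finite_weylGroup b
  have := Fintype.ofFinite P.weylGroup
  suffices ∀ (n : ℕ) (x : P.weylGroup), len b x = n → ∀ u, T u (u * x) by
    simpa using this _ (u⁻¹ * v) rfl u
  intro n
  induction n using Nat.strong_induction_on with
  | _ n ih =>
  rintro x rfl
  by_contra! hbad
  obtain ⟨u₀, hu₀⟩ := hbad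
  -- The bad starting points for a fixed `x = u⁻¹v`.
  let U : Finset P.weylGroup := {u | ¬ T u (u * x)}
  have mem : ∀ {u}, u ∈ U ↔ ¬ T u (u * x) := by simp [U]
  have key : ∀ a, IsAffineSimple b a → ∀ u ∈ U, b.IsPos (u⁻¹ • a) →
      b.IsPos ((u * x)⁻¹ • a) ∧ refl P a * u ∈ U := by
    intro a ha u hu hpos
    have hx : b.IsPos ((u * x)⁻¹ • a) := by
      by_contra hneg
      have h1 : refl P a * (u * x) = u * (refl P (u⁻¹ • a) * x) := by
        rw [← mul_assoc, refl_mul_eq, mul_assoc]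
      have h2 : u * x = (refl P a * u) * (refl P (u⁻¹ • a) * x) := by
        rw [mul_assoc, ← h1, refl_mul_refl_mul]
      have h3 : len b (refl P (u⁻¹ • a) * x) < len b x :=
        len_refl_mul_lt hpos (by rwa [← mul_smul, ← mul_inv_rev])
      refine mem.mp hu (cross a ha u _ hpos hneg ?_ ?_)
      · rw [h1]; exact ih _ h3 _ rfl u
      · conv => arg 2; rw [h2]
        exact ih _ h3 _ rfl _
    refine ⟨hx, mem.mpr fun h => mem.mp hu (lift a ha u _ hpos hx ?_)⟩
    rwa [← mul_assoc]
  have hclosed : ∀ α ∈ b.support, ∀ u ∈ U, refl P α * u ∈ U := fun α hα =>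
    refl_mul_mem_of_closed (fun a ha u hu hp => (key a ha u hu hp).2) hα
  have hword : ∀ l : List b.support, wordProd b l * u₀ ∈ U := by
    intro l
    induction l with
    | nil => simpa using mem.mpr hu₀
    | cons i l ihl => rw [wordProd_cons, mul_assoc]; exact hclosed i i.2 _ ihl
  obtain ⟨l, hl⟩ := exists_wordProd_eq (b := b) u₀⁻¹
  have h1 := hword l
  rw [hl, inv_mul_cancel] at h1
  obtain ⟨l', hl', hlen⟩ := exists_isReducedWord b x
  obtain - | ⟨i, l'⟩ := l'
  · rw [wordProd_nil] at hl'
    exact hu₀ (by rw [← hl', mul_one]; exact self u₀)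
  -- Now `1` is bad, so `x⁻¹α_i` is positive for every simple root; this fails for the first letter
  -- of a reduced word of `x`.
  · have h2 := (key i (isAffineSimple_of_mem_support i.2) 1 h1
      (by simpa using b.isPos_of_mem_support i.2)).1
    rw [one_mul] at h2
    have h3 := len_simple_mul_of_isPos i.2 h2
    rw [← hl', wordProd_cons, refl_mul_refl_mul, ← wordProd_cons, hl', ← hlen,
      List.length_cons] at h3
    have := len_wordProd_le l'
    omega

/-! ### Reflection orders -/

section

/-- The function `κ` enumerates the positive roots according to a reflection order: its final
segments are inversion sets, and a product of reflections in increasing order is trivial only if it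
is empty. -/
structure IsReflectionOrder (b : P.Base) (κ : ι → ℕ) : Prop where
  inj : ∀ β γ, b.IsPos β → b.IsPos γ → κ β = κ γ → β = γ
  seg : ∀ n, ∃ y : P.weylGroup, ∀ β, b.IsPos β → (n ≤ κ β ↔ ¬ b.IsPos (y • β))
  eq_nil : ∀ L : List ι, (∀ β ∈ L, b.IsPos β) → L.Pairwise (κ · < κ ·) →
    (L.map (refl P)).prod = 1 → L = []

namespace IsReflectionOrder

variable {κ : ι → ℕ} (hκ : IsReflectionOrder b κ) {β δ : ι}
include hκ

/-- Write `s_β δ = δ - cβ`. Some `y` inverts exactly the roots from `β` on, another exactly those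
after `β`; according to the sign of `c`, one of them sends `s_β δ` to a sum with nonnegative
coefficients of positive roots. The next lemmas use the same argument. -/
theorem refl_lt_of_lt (hβ : b.IsPos β) (hδ : b.IsPos δ) (hlt : κ δ < κ β)
    (hp : b.IsPos (refl P β • δ)) : κ (refl P β • δ) < κ β := by
  rcases le_or_gt (P.pairingIn ℤ δ β) 0 with hc | hc
  · obtain ⟨y, hy⟩ := hκ.seg (κ β + 1)
    have h1 : b.IsPos (y • β) := by
      by_contra h; have := (hy β hβ).mpr h; omega
    have h2 : b.IsPos (y • δ) := by
      by_contra h; have := (hy δ hδ).mpr h; omega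
    have h3 : b.IsPos (y • refl P β • δ) := by
      rw [Base.isPos_iff] at h1 h2 ⊢
      rw [height_smul_refl_smul]
      nlinarith
    have h4 : κ (refl P β • δ) ≤ κ β := by
      by_contra h
      exact (hy _ hp).mp (by omega) h3
    refine lt_of_le_of_ne h4 fun h => ?_
    have h5 := hκ.inj _ _ hp hβ h
    have h6 : δ = opp P β := by
      rw [← refl_smul_refl_smul (P := P) β δ, h5, refl_smul_self]
    rw [h6, isPos_opp] at hδ
    exact hδ hβ
  · obtain ⟨y, hy⟩ := hκ.seg (κ β)
    have h1 : ¬ b.IsPos (y • β) := (hy β hβ).mp le_rfl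
    have h2 : b.IsPos (y • δ) := by
      by_contra h; have := (hy δ hδ).mpr h; omega
    have h3 : b.IsPos (y • refl P β • δ) := by
      rw [not_isPos_iff] at h1
      rw [Base.isPos_iff] at h2 ⊢
      rw [height_smul_refl_smul]
      nlinarith
    by_contra h
    exact (hy _ hp).mp (by omega) h3

theorem lt_opp_refl_of_lt (hβ : b.IsPos β) (hδ : b.IsPos δ) (hlt : κ δ < κ β)
    (hp : ¬ b.IsPos (refl P β • δ)) : κ β < κ (opp P (refl P β • δ)) := by
  have hc : 0 < P.pairingIn ℤ δ β := by
    rw [Base.isPos_iff] at hβ hδ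
    rw [not_isPos_iff, height_refl_smul] at hp
    by_contra h
    nlinarith
  obtain ⟨y, hy⟩ := hκ.seg (κ β)
  have h1 : ¬ b.IsPos (y • β) := (hy β hβ).mp le_rfl
  have h2 : b.IsPos (y • δ) := by
    by_contra h; have := (hy δ hδ).mpr h; omega
  have h3 : b.IsPos (y • refl P β • δ) := by
    rw [not_isPos_iff] at h1
    rw [Base.isPos_iff] at h2 ⊢
    rw [height_smul_refl_smul]
    nlinarith
  have hp' := isPos_opp.mpr hp
  have h4 : κ β ≤ κ (opp P (refl P β • δ)) := by
    rw [hy _ hp', smul_opp, isPos_opp, not_not]; exact h3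
  refine lt_of_le_of_ne h4 fun h => ?_
  have h5 := hκ.inj _ _ hβ hp' h
  have h6 : δ = β := by
    rw [← refl_smul_refl_smul (P := P) β δ, ← opp_opp (P := P) (refl P β • δ), ← h5, smul_opp,
      refl_smul_self, opp_opp]
  rw [h6] at hlt
  omega

theorem lt_refl_of_lt (hβ : b.IsPos β) (hδ : b.IsPos δ) (hlt : κ β < κ δ)
    (hp : b.IsPos (refl P β • δ)) : κ β < κ (refl P β • δ) := by
  rcases lt_trichotomy (κ β) (κ (refl P β • δ)) with h | h | h
  · exact h
  · have h5 := hκ.inj _ _ hβ hp h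
    have h6 : δ = opp P β := by
      rw [← refl_smul_refl_smul (P := P) β δ, ← h5, refl_smul_self]
    rw [h6, isPos_opp] at hδ
    exact absurd hβ hδ
  · have := hκ.refl_lt_of_lt hβ hp h (by simpa using hδ)
    rw [refl_smul_refl_smul] at this
    omega

theorem opp_refl_lt_of_lt (hβ : b.IsPos β) (hδ : b.IsPos δ) (hlt : κ β < κ δ)
    (hp : ¬ b.IsPos (refl P β • δ)) : κ (opp P (refl P β • δ)) < κ β := by
  have hc : 0 < P.pairingIn ℤ δ β := by
    rw [Base.isPos_iff] at hβ hδ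
    rw [not_isPos_iff, height_refl_smul] at hp
    by_contra h
    nlinarith
  obtain ⟨y, hy⟩ := hκ.seg (κ β + 1)
  have h1 : b.IsPos (y • β) := by
    by_contra h; have := (hy β hβ).mpr h; omega
  have h2 : ¬ b.IsPos (y • δ) := (hy δ hδ).mp hlt
  have h3 : ¬ b.IsPos (y • refl P β • δ) := by
    rw [Base.isPos_iff] at h1
    rw [not_isPos_iff] at h2 ⊢
    rw [height_smul_refl_smul]
    nlinarith
  have hp' := isPos_opp.mpr hp
  have h4 : κ (opp P (refl P β • δ)) ≤ κ β := by
    by_contra h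
    have := (hy _ hp').mp (by omega)
    rw [smul_opp, isPos_opp] at this
    exact this h3
  refine lt_of_le_of_ne h4 fun h => ?_
  have h5 := hκ.inj _ _ hp' hβ h
  have h6 : δ = β := by
    rw [← refl_smul_refl_smul (P := P) β δ, ← opp_opp (P := P) (refl P β • δ), h5, smul_opp,
      refl_smul_self, opp_opp]
  rw [h6] at hlt
  omega

end IsReflectionOrder

/-! ### The label of `x → s_a x` and how it moves along an edge -/

open Classical in
/-- The positive one of the two roots `± x⁻¹ a`: the positive root `β` with `s_a x = x s_β`. -/
noncomputable def label (b : P.Base) (a : ι) (x : P.weylGroup) : ι :=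
  if b.IsPos (x⁻¹ • a) then x⁻¹ • a else opp P (x⁻¹ • a)

variable {a : ι} {x y : P.weylGroup} {β : ι}

theorem label_of_isPos (h : b.IsPos (x⁻¹ • a)) : label b a x = x⁻¹ • a := if_pos h

theorem label_of_not_isPos (h : ¬ b.IsPos (x⁻¹ • a)) : label b a x = opp P (x⁻¹ • a) := if_neg h

theorem isPos_label : b.IsPos (label b a x) := by
  by_cases h : b.IsPos (x⁻¹ • a)
  · rwa [label_of_isPos h]
  · rwa [label_of_not_isPos h, isPos_opp]

theorem mul_refl_label : x * refl P (label b a x) = refl P a * x := by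
  rw [refl_mul_eq]
  by_cases h : b.IsPos (x⁻¹ • a)
  · rw [label_of_isPos h]
  · rw [label_of_not_isPos h, refl_opp]

theorem label_refl_mul : label b a (refl P a * x) = label b a x := by
  by_cases h : b.IsPos (x⁻¹ • a)
  · have h' : ¬ b.IsPos ((refl P a * x)⁻¹ • a) := by rw [isPos_refl_mul_inv_smul]; tauto
    rw [label_of_isPos h, label_of_not_isPos h', mul_inv_rev, refl_inv, mul_smul, refl_smul_self,
      smul_opp, opp_opp]
  · have h' : b.IsPos ((refl P a * x)⁻¹ • a) := by rw [isPos_refl_mul_inv_smul]; tauto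
    rw [label_of_not_isPos h, label_of_isPos h', mul_inv_rev, refl_inv, mul_smul, refl_smul_self,
      smul_opp]

theorem inv_smul_of_eq_mul_refl (hy : y = x * refl P β) : y⁻¹ • a = refl P β • x⁻¹ • a := by
  rw [hy, mul_inv_rev, refl_inv, mul_smul]

theorem label_eq_of_same (hy : y = x * refl P β)
    (h : b.IsPos (x⁻¹ • a) ↔ b.IsPos (y⁻¹ • a)) : label b a y = refl P β • label b a x := by
  by_cases hx : b.IsPos (x⁻¹ • a)
  · rw [label_of_isPos hx, label_of_isPos (h.mp hx), inv_smul_of_eq_mul_refl hy]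
  · rw [label_of_not_isPos hx, label_of_not_isPos (mt h.mpr hx), inv_smul_of_eq_mul_refl hy,
      smul_opp]

theorem label_eq_of_change (hy : y = x * refl P β)
    (h : b.IsPos (x⁻¹ • a) ↔ ¬ b.IsPos (y⁻¹ • a)) :
    label b a y = opp P (refl P β • label b a x) := by
  by_cases hx : b.IsPos (x⁻¹ • a)
  · rw [label_of_isPos hx, label_of_not_isPos (h.mp hx), inv_smul_of_eq_mul_refl hy]
  · have hy' : b.IsPos (y⁻¹ • a) := by tauto
    rw [label_of_not_isPos hx, label_of_isPos hy', inv_smul_of_eq_mul_refl hy, smul_opp, opp_opp]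

section LabelOrder

variable {κ : ι → ℕ} (hκ : IsReflectionOrder b κ)
include hκ

theorem eq_label (hβ : b.IsPos β) (h : κ β = κ (label b a x)) : β = label b a x :=
  hκ.inj _ _ hβ isPos_label h

/-- Along an edge labelled `β` that stays on one side of `a`, the comparison between `β` and the
label of `a` persists; along an edge that changes sides it is reversed. These four lemmas keep
increasing paths increasing after an insertion. -/
theorem label_lt_of_same (hβ : b.IsPos β) (hy : y = x * refl P β)
    (h : b.IsPos (x⁻¹ • a) ↔ b.IsPos (y⁻¹ • a)) (hlt : κ (label b a x) < κ β) :
    κ (label b a y) < κ β := by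
  have h' := label_eq_of_same hy h
  rw [h']
  exact hκ.refl_lt_of_lt hβ isPos_label hlt (h' ▸ isPos_label)

theorem lt_label_of_same (hβ : b.IsPos β) (hy : y = x * refl P β)
    (h : b.IsPos (x⁻¹ • a) ↔ b.IsPos (y⁻¹ • a)) (hlt : κ β < κ (label b a x)) :
    κ β < κ (label b a y) := by
  have h' := label_eq_of_same hy h
  rw [h']
  exact hκ.lt_refl_of_lt hβ isPos_label hlt (h' ▸ isPos_label)

theorem lt_label_of_change (hβ : b.IsPos β) (hy : y = x * refl P β)
    (h : b.IsPos (x⁻¹ • a) ↔ ¬ b.IsPos (y⁻¹ • a)) (hlt : κ (label b a x) < κ β) :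
    κ β < κ (label b a y) := by
  have h' := label_eq_of_change hy h
  rw [h']
  exact hκ.lt_opp_refl_of_lt hβ isPos_label hlt (isPos_opp.mp (h' ▸ isPos_label))

theorem label_lt_of_change (hβ : b.IsPos β) (hy : y = x * refl P β)
    (h : b.IsPos (x⁻¹ • a) ↔ ¬ b.IsPos (y⁻¹ • a)) (hlt : κ β < κ (label b a x)) :
    κ (label b a y) < κ β := by
  have h' := label_eq_of_change hy h
  rw [h']
  exact hκ.opp_refl_lt_of_lt hβ isPos_label hlt (isPos_opp.mp (h' ▸ isPos_label))

end LabelOrder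

end

/-! ### Paths and the deletion of crossing edges -/

section

variable {u v x y z : P.weylGroup} {L L' : List ι} {β a : ι}

theorem IsPath.eq_nil_iff (h : IsPath b u [] v) : u = v := by
  cases h; rfl

theorem isPath_cons : IsPath b u (β :: L) v ↔ ∃ y, IsEdge b u β y ∧ IsPath b y L v := by
  constructor
  · rintro (_ | ⟨h, h'⟩)
    exact ⟨_, h, h'⟩
  · rintro ⟨y, h, h'⟩
    exact .cons h h'

theorem IsPath.append (h : IsPath b u L v) (h' : IsPath b v L' z) : IsPath b u (L ++ L') z := by
  induction h with
  | nil => exact h'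
  | cons e _ ih => exact .cons e (ih h')

theorem IsPath.eq_mul (h : IsPath b u L v) : v = u * (L.map (refl P)).prod := by
  induction h with
  | nil => simp
  | cons e _ ih => rw [ih, e.2.1, List.map_cons, List.prod_cons, mul_assoc]

theorem IsPath.isPos (h : IsPath b u L v) : ∀ β ∈ L, b.IsPos β := by
  induction h with
  | nil => simp
  | cons e _ ih => simpa using ⟨e.1, ih⟩

theorem IsAffineSimple.isEdge_label (ha : IsAffineSimple b a) (hx : b.IsPos (x⁻¹ • a)) :
    IsEdge b x (label b a x) (refl P a * x) := by
  rw [label_of_isPos hx]; exact ha.edge x hx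

theorem IsEdge.eq_refl_mul (h : IsEdge b x (label b a x) y) : y = refl P a * x := by
  rw [h.2.1, mul_refl_label]

theorem IsAffineSimple.eq_label (ha : IsAffineSimple b a) (h : IsEdge b x β y)
    (hx : b.IsPos (x⁻¹ • a)) (hy : ¬ b.IsPos (y⁻¹ • a)) : β = label b a x := by
  rw [label_of_isPos hx]; exact ha.cross x β y h hx hy

/-- From the positive to the negative side of `a`: the first edge crossing over is deleted. -/
theorem IsPath.delete_first (ha : IsAffineSimple b a) (h : IsPath b u L v)
    (hu : b.IsPos (u⁻¹ • a)) (hv : ¬ b.IsPos (v⁻¹ • a)) :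
    ∃ L', L'.Sublist L ∧ L'.length + 1 = L.length ∧ IsPath b (refl P a * u) L' v := by
  induction h with
  | nil => exact absurd hu hv
  | @cons u y v β L e h ih =>
    by_cases hy : b.IsPos (y⁻¹ • a)
    · obtain ⟨L', h1, h2, h3⟩ := ih hy hv
      exact ⟨β :: L', h1.cons_cons β, by simp [h2], .cons (ha.lift _ _ _ e (by tauto)) h3⟩
    · obtain rfl := ha.eq_label e hu hy
      refine ⟨L, List.sublist_cons_self _ _, rfl, ?_⟩
      rwa [← e.eq_refl_mul]

theorem IsPath.delete_last_aux (ha : IsAffineSimple b a) (h : IsPath b u L v)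
    (hv : ¬ b.IsPos (v⁻¹ • a)) :
    (¬ b.IsPos (u⁻¹ • a) ∧ IsPath b (refl P a * u) L (refl P a * v)) ∨
    ∃ L', L'.Sublist L ∧ L'.length + 1 = L.length ∧ IsPath b u L' (refl P a * v) := by
  induction h with
  | nil => exact Or.inl ⟨hv, .nil _⟩
  | @cons u y v β L e h ih =>
    rcases ih hv with ⟨hy, h'⟩ | ⟨L', h1, h2, h3⟩
    · by_cases hu : b.IsPos (u⁻¹ • a)
      · obtain rfl := ha.eq_label e hu hy
        refine Or.inr ⟨L, List.sublist_cons_self _ _, rfl, ?_⟩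
        rwa [e.eq_refl_mul, refl_mul_refl_mul] at h'
      · exact Or.inl ⟨hu, .cons (ha.lift _ _ _ e (by tauto)) h'⟩
    · exact Or.inr ⟨β :: L', h1.cons_cons β, by simp [h2], .cons e h3⟩

/-- From the positive to the negative side of `a`: the last edge crossing over is deleted. -/
theorem IsPath.delete_last (ha : IsAffineSimple b a) (h : IsPath b u L v)
    (hu : b.IsPos (u⁻¹ • a)) (hv : ¬ b.IsPos (v⁻¹ • a)) :
    ∃ L', L'.Sublist L ∧ L'.length + 1 = L.length ∧ IsPath b u L' (refl P a * v) :=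
  (h.delete_last_aux ha hv).resolve_left fun h => h.1 hu

/-! ### Increasing paths: insertion, existence, minimality, uniqueness -/

/-- A directed path with increasing labels. -/
def IsIncPath (b : P.Base) (κ : ι → ℕ) (u : P.weylGroup) (L : List ι) (v : P.weylGroup) : Prop :=
  IsPath b u L v ∧ L.Pairwise (κ · < κ ·)

variable {κ : ι → ℕ}

theorem isIncPath_nil (u : P.weylGroup) : IsIncPath b κ u [] u := ⟨.nil u, .nil⟩

theorem isIncPath_cons : IsIncPath b κ u (β :: L) v ↔
    ∃ y, IsEdge b u β y ∧ IsIncPath b κ y L v ∧ ∀ l ∈ L, κ β < κ l := by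
  rw [IsIncPath, isPath_cons, List.pairwise_cons]
  constructor
  · rintro ⟨⟨y, h1, h2⟩, h3, h4⟩
    exact ⟨y, h1, ⟨h2, h4⟩, h3⟩
  · rintro ⟨y, h1, ⟨h2, h4⟩, h3⟩
    exact ⟨⟨y, h1, h2⟩, h3, h4⟩

theorem IsIncPath.lt_of_lt {n : ℕ} (h : IsIncPath b κ u (β :: L) v) (hn : n < κ β) :
    ∀ l ∈ β :: L, n < κ l := by
  obtain ⟨y, -, -, h⟩ := isIncPath_cons.mp h
  simpa using ⟨hn, fun l hl => hn.trans (h l hl)⟩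

theorem IsReflectionOrder.eq_nil_of_isIncPath (hκ : IsReflectionOrder b κ)
    (h : IsIncPath b κ u L u) : L = [] :=
  hκ.eq_nil L h.1.isPos h.2 (by simpa using h.1.eq_mul)

/-- Leaving the positive side would require an edge with the current label of `a`, but that label
stays below all remaining ones. -/
theorem IsIncPath.stays_pos (hκ : IsReflectionOrder b κ) (ha : IsAffineSimple b a)
    (h : IsIncPath b κ u L v) (hu : b.IsPos (u⁻¹ • a)) (hL : ∀ l ∈ L, κ (label b a u) < κ l) :
    b.IsPos (v⁻¹ • a) ∧ IsPath b (refl P a * u) L (refl P a * v) := by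
  induction L generalizing u with
  | nil => obtain rfl := h.1.eq_nil_iff; exact ⟨hu, .nil _⟩
  | cons β L ih =>
    obtain ⟨y, e, h, hβ⟩ := isIncPath_cons.mp h
    have hlt := hL β (by simp)
    have hy : b.IsPos (y⁻¹ • a) := by
      by_contra hy
      rw [← ha.eq_label e hu hy] at hlt
      omega
    have := label_lt_of_same hκ e.1 e.2.1 (by tauto) hlt
    obtain ⟨h1, h2⟩ := ih h hy fun l hl => this.trans (hβ l hl)
    exact ⟨h1, .cons (ha.lift _ _ _ e (by tauto)) h2⟩

/-- Reverses `delete_first`: edges with labels below that of `a` are reflected, and the edge for `a`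
is inserted where its label fits. The bounds by `n` keep the labels increasing in the induction. -/
theorem IsIncPath.insert_first (hκ : IsReflectionOrder b κ) (ha : IsAffineSimple b a)
    (h : IsIncPath b κ (refl P a * u) L v) (hu : b.IsPos (u⁻¹ • a)) (hv : ¬ b.IsPos (v⁻¹ • a)) :
    ∃ L', IsIncPath b κ u L' v ∧ L'.length = L.length + 1 ∧
      ∀ n ≤ κ (label b a u), (∀ l ∈ L, n ≤ κ l) → ∀ l ∈ L', n ≤ κ l := by
  have hu' : ¬ b.IsPos ((refl P a * u)⁻¹ • a) := by rw [isPos_refl_mul_inv_smul]; tauto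
  induction L generalizing u with
  | nil =>
    obtain rfl := h.1.eq_nil_iff
    refine ⟨[label b a u], isIncPath_cons.mpr ⟨_, ha.isEdge_label hu, h, by simp⟩, rfl, ?_⟩
    simp
  | cons β L ih =>
    obtain ⟨y, e, h', hβ⟩ := isIncPath_cons.mp h
    rcases lt_trichotomy (κ β) (κ (label b a u)) with hlt | heq | hgt
    · by_cases hy : b.IsPos (y⁻¹ • a)
      · rw [← label_refl_mul] at hlt
        have := label_lt_of_change hκ e.1 e.2.1 (by tauto) hlt
        exact absurd (h'.stays_pos hκ ha hy fun l hl => this.trans (hβ l hl)).1 hv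
      · have hsy : b.IsPos ((refl P a * y)⁻¹ • a) := by rw [isPos_refl_mul_inv_smul]; exact hy
        have e' := ha.lift _ _ _ e (by tauto)
        rw [refl_mul_refl_mul] at e'
        obtain ⟨L', h1, h2, h3⟩ := ih (u := refl P a * y) (by simpa using h') hsy (by simpa using hy)
        have hl := lt_label_of_same hκ e'.1 e'.2.1 (by tauto) hlt
        refine ⟨β :: L', isIncPath_cons.mpr ⟨_, e', h1, h3 (κ β + 1) hl hβ⟩, by simp [h2], ?_⟩
        intro n hn hn'
        simp only [List.mem_cons, forall_eq_or_imp] at hn' ⊢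
        exact ⟨hn'.1, h3 n (hn'.1.trans hl.le) hn'.2⟩
    · obtain rfl := eq_label hκ e.1 heq
      have : y = u := by rw [e.2.1, ← label_refl_mul, mul_refl_label, refl_mul_refl_mul]
      subst this
      exact absurd (h'.stays_pos hκ ha hu hβ).1 hv
    · refine ⟨label b a u :: β :: L,
        isIncPath_cons.mpr ⟨_, ha.isEdge_label hu, h, h.lt_of_lt hgt⟩, rfl, ?_⟩
      intro n hn hn'
      simpa using ⟨hn, by simpa using hn'⟩

/-- Reverses `delete_last`. The two claims need each other, since the path may change sides at an
edge labelled by `a` or return to the positive side. The final clause of the second claim, used for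
uniqueness, says that the new labels cannot be followed from `s_a u`. -/
theorem IsIncPath.insert_last_aux (hκ : IsReflectionOrder b κ) (ha : IsAffineSimple b a)
    (h : IsIncPath b κ u L z) (hz : b.IsPos (z⁻¹ • a)) :
    (b.IsPos (u⁻¹ • a) → ∃ L', IsIncPath b κ u L' (refl P a * z) ∧ L'.length = L.length + 1 ∧
      ∀ n ≤ κ (label b a u), (∀ l ∈ L, n ≤ κ l) → ∀ l ∈ L', n ≤ κ l) ∧
    (¬ b.IsPos (u⁻¹ • a) → (∀ l ∈ L, κ (label b a u) < κ l) →
      ∃ L', IsIncPath b κ u L' (refl P a * z) ∧ L'.length = L.length + 1 ∧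
      (∀ n, (∀ l ∈ L, n ≤ κ l) → ∀ l ∈ L', n ≤ κ l) ∧ ∀ v', ¬ IsPath b (refl P a * u) L' v') := by
  induction L generalizing u with
  | nil =>
    obtain rfl := h.1.eq_nil_iff
    refine ⟨fun hu => ⟨[label b a u],
      isIncPath_cons.mpr ⟨_, ha.isEdge_label hu, isIncPath_nil _, by simp⟩, rfl, by simp⟩, ?_⟩
    exact fun hu => absurd hz hu
  | cons β L ih =>
    obtain ⟨y, e, h', hβ⟩ := isIncPath_cons.mp h
    obtain ⟨ih1, ih2⟩ := ih h'
    constructor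
    · intro hu
      rcases lt_trichotomy (κ β) (κ (label b a u)) with hlt | heq | hgt
      · have hy : b.IsPos (y⁻¹ • a) := by
          by_contra hy
          rw [← ha.eq_label e hu hy] at hlt
          omega
        have hl := lt_label_of_same hκ e.1 e.2.1 (by tauto) hlt
        obtain ⟨L', h1, h2, h3⟩ := ih1 hy
        refine ⟨β :: L', isIncPath_cons.mpr ⟨_, e, h1, h3 (κ β + 1) hl hβ⟩, by simp [h2], ?_⟩
        intro n hn hn'
        simp only [List.mem_cons, forall_eq_or_imp] at hn' ⊢
        exact ⟨hn'.1, h3 n (hn'.1.trans hl.le) hn'.2⟩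
      · obtain rfl := eq_label hκ e.1 heq
        have hyu := e.eq_refl_mul
        have hy : ¬ b.IsPos (y⁻¹ • a) := by rw [hyu, isPos_refl_mul_inv_smul]; tauto
        obtain ⟨L', h1, h2, h3, -⟩ := ih2 hy (by rw [hyu, label_refl_mul]; exact hβ)
        refine ⟨_ :: L', isIncPath_cons.mpr ⟨_, e, h1, h3 _ hβ⟩, by simp [h2], ?_⟩
        intro n hn hn'
        simp only [List.mem_cons, forall_eq_or_imp] at hn' ⊢
        exact ⟨hn'.1, h3 n hn'.2⟩
      · have h1 := h.lt_of_lt hgt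
        refine ⟨label b a u :: β :: L, isIncPath_cons.mpr ⟨_, ha.isEdge_label hu,
          ⟨(h.stays_pos hκ ha hu h1).2, h.2⟩, h1⟩, rfl, ?_⟩
        intro n hn hn'
        simpa using ⟨hn, by simpa using hn'⟩
    · intro hu hL
      have hlt := hL β (by simp)
      by_cases hy : b.IsPos (y⁻¹ • a)
      · have hl := lt_label_of_change hκ e.1 e.2.1 (by tauto) hlt
        obtain ⟨L', h1, h2, h3⟩ := ih1 hy
        refine ⟨β :: L', isIncPath_cons.mpr ⟨_, e, h1, h3 (κ β + 1) hl hβ⟩, by simp [h2], ?_, ?_⟩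
        · intro n hn'
          simp only [List.mem_cons, forall_eq_or_imp] at hn' ⊢
          exact ⟨hn'.1, h3 n (hn'.1.trans hl.le) hn'.2⟩
        · intro v' hp
          obtain ⟨y', e', -⟩ := isPath_cons.mp hp
          have hy' : y' = refl P a * y := by rw [e'.2.1, e.2.1, mul_assoc]
          have h4 := ha.eq_label e' (by rw [isPos_refl_mul_inv_smul]; exact hu)
            (by rw [hy', isPos_refl_mul_inv_smul]; tauto)
          rw [label_refl_mul] at h4
          rw [← h4] at hlt
          omega
      · have hl := label_lt_of_same hκ e.1 e.2.1 (by tauto) hlt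
        obtain ⟨L', h1, h2, h3, h4⟩ := ih2 hy fun l hl' => hl.trans (hβ l hl')
        refine ⟨β :: L', isIncPath_cons.mpr ⟨_, e, h1, h3 (κ β + 1) hβ⟩, by simp [h2], ?_, ?_⟩
        · intro n hn'
          simp only [List.mem_cons, forall_eq_or_imp] at hn' ⊢
          exact ⟨hn'.1, h3 n hn'.2⟩
        · intro v' hp
          obtain ⟨y', e', hp'⟩ := isPath_cons.mp hp
          have hy' : y' = refl P a * y := by rw [e'.2.1, e.2.1, mul_assoc]
          rw [hy'] at hp'
          exact h4 v' hp'

/-- There is an increasing path from `u` to `v`, and increasing paths from `u` to `v` are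
shortest. -/
theorem increasing_path (hκ : IsReflectionOrder b κ) (u v : P.weylGroup) :
    (∃ L, IsIncPath b κ u L v) ∧
      ∀ L L', IsIncPath b κ u L v → IsPath b u L' v → L.length ≤ L'.length := by
  refine tilted_induction (b := b) (T := fun u v => (∃ L, IsIncPath b κ u L v) ∧
      ∀ L L', IsIncPath b κ u L v → IsPath b u L' v → L.length ≤ L'.length) ?_ ?_ ?_ u v
  · intro u
    refine ⟨⟨[], isIncPath_nil u⟩, fun L L' h _ => ?_⟩
    rw [hκ.eq_nil_of_isIncPath h]
    exact Nat.zero_le _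
  · rintro a ha u v hu hv ⟨⟨L₀, h₀⟩, hmin⟩ -
    have hv' : b.IsPos ((refl P a * v)⁻¹ • a) := by rw [isPos_refl_mul_inv_smul]; exact hv
    constructor
    · obtain ⟨L', h1, -⟩ := (h₀.insert_last_aux hκ ha hv').1 hu
      rw [refl_mul_refl_mul] at h1
      exact ⟨L', h1⟩
    · intro L L' h h'
      obtain ⟨L₁, h1, h2, h3⟩ := h.1.delete_last ha hu hv
      obtain ⟨L₂, _, h5, h6⟩ := h'.delete_last ha hu hv
      have := hmin L₁ L₂ ⟨h3, h.2.sublist h1⟩ h6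
      omega
  · rintro a ha u v hu hv ⟨⟨L₀, h₀⟩, hmin⟩
    have hv' : ¬ b.IsPos ((refl P a * v)⁻¹ • a) := by rw [isPos_refl_mul_inv_smul]; tauto
    constructor
    -- The path from `s_a u` to `s_a v` is extended to one from `u`, and its last crossing edge is
    -- deleted.
    · obtain ⟨L', h1, -⟩ := h₀.insert_first hκ ha hu hv'
      obtain ⟨L'', h2, -, h3⟩ := h1.1.delete_last ha hu hv'
      rw [refl_mul_refl_mul] at h3
      exact ⟨L'', h3, h1.2.sublist h2⟩
    · intro L L' h h'
      -- Both paths are carried to paths from `s_a u` to `s_a v` of unchanged length; only the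
      -- increasing one must remain increasing.
      obtain ⟨L₁, h1, h2, -⟩ := (h.insert_last_aux hκ ha hv).1 hu
      obtain ⟨L₂, h3, h4, h5⟩ := h1.1.delete_first ha hu hv'
      obtain ⟨L₃, _, h7, h8⟩ := (h'.append (.cons (ha.isEdge_label hv) (.nil _))).delete_first ha
        hu hv'
      have := hmin L₂ L₃ ⟨h5, h1.2.sublist h3⟩ h8
      rw [List.length_append, List.length_singleton] at h7
      omega

/-- The three alternatives exclude one another, so the first label can be read off from the
reflected path; `delete_cons` does the same for the crossing move. -/
theorem IsIncPath.lift_cons (hκ : IsReflectionOrder b κ) (ha : IsAffineSimple b a)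
    (h : IsIncPath b κ u (β :: L) v) (hu : b.IsPos (u⁻¹ • a)) (hv : b.IsPos (v⁻¹ • a)) :
    ∃ L', IsIncPath b κ (refl P a * u) L' (refl P a * v) ∧ L'.length = L.length + 1 ∧
      ((κ β < κ (label b a u) ∧ L'.head? = some β) ∨
        (β = label b a u ∧ (∀ l ∈ L', κ (label b a u) < κ l) ∧ ∀ v', ¬ IsPath b u L' v') ∨
        (κ (label b a u) < κ β ∧ L' = β :: L)) := by
  obtain ⟨y, e, h', hβ⟩ := isIncPath_cons.mp h
  rcases lt_trichotomy (κ β) (κ (label b a u)) with hlt | heq | hgt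
  · have hy : b.IsPos (y⁻¹ • a) := by
      by_contra hy
      rw [← ha.eq_label e hu hy] at hlt
      omega
    have hl := lt_label_of_same hκ e.1 e.2.1 (by tauto) hlt
    obtain ⟨L₁, h1, h2, h3⟩ := (h'.insert_last_aux hκ ha hv).1 hy
    obtain ⟨L₂, h4, h5, h6⟩ := h1.1.delete_first ha hy
      (by rw [isPos_refl_mul_inv_smul]; tauto)
    refine ⟨β :: L₂, isIncPath_cons.mpr ⟨_, ha.lift _ _ _ e (by tauto), ⟨h6, h1.2.sublist h4⟩,
      fun l hl' => h3 (κ β + 1) hl hβ l (h4.subset hl')⟩, ?_, Or.inl ⟨hlt, rfl⟩⟩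
    rw [List.length_cons]
    omega
  · obtain rfl := eq_label hκ e.1 heq
    have hyu := e.eq_refl_mul
    have hy : ¬ b.IsPos (y⁻¹ • a) := by rw [hyu, isPos_refl_mul_inv_smul]; tauto
    obtain ⟨L', h1, h2, h3, h4⟩ := (h'.insert_last_aux hκ ha hv).2 hy
      (by rw [hyu, label_refl_mul]; exact hβ)
    rw [hyu] at h1 h4
    rw [refl_mul_refl_mul] at h4
    exact ⟨L', h1, h2, Or.inr (Or.inl ⟨rfl, h3 _ hβ, h4⟩)⟩
  · exact ⟨β :: L, ⟨(h.stays_pos hκ ha hu (h.lt_of_lt hgt)).2, h.2⟩, rfl,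
      Or.inr (Or.inr ⟨hgt, rfl⟩)⟩

theorem IsIncPath.delete_cons (hκ : IsReflectionOrder b κ) (ha : IsAffineSimple b a)
    (h : IsIncPath b κ u (β :: L) v) (hu : b.IsPos (u⁻¹ • a)) (hv : ¬ b.IsPos (v⁻¹ • a)) :
    ∃ L', IsIncPath b κ (refl P a * u) L' v ∧ L'.length = L.length ∧
      ((κ β < κ (label b a u) ∧ L'.head? = some β) ∨
        (β = label b a u ∧ ∀ l ∈ L', κ (label b a u) < κ l)) := by
  obtain ⟨y, e, h', hβ⟩ := isIncPath_cons.mp h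
  rcases lt_trichotomy (κ β) (κ (label b a u)) with hlt | heq | hgt
  · have hy : b.IsPos (y⁻¹ • a) := by
      by_contra hy
      rw [← ha.eq_label e hu hy] at hlt
      omega
    obtain ⟨L₂, h4, h5, h6⟩ := h'.1.delete_first ha hy hv
    exact ⟨β :: L₂, isIncPath_cons.mpr ⟨_, ha.lift _ _ _ e (by tauto), ⟨h6, h'.2.sublist h4⟩,
      fun l hl' => hβ l (h4.subset hl')⟩, h5, Or.inl ⟨hlt, rfl⟩⟩
  · obtain rfl := _root_.QuantumBruhat.eq_label hκ e.1 heq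
    rw [e.eq_refl_mul] at h'
    exact ⟨L, h', rfl, Or.inr ⟨rfl, hβ⟩⟩
  · exact absurd (h.stays_pos hκ ha hu (h.lt_of_lt hgt)).1 hv

/-- The transformed paths agree by induction, which forces equal first labels. The outer induction
on the length then settles the tails. -/
theorem IsIncPath.eq_of_length_eq (hκ : IsReflectionOrder b κ) (n : ℕ) :
    ∀ (u v : P.weylGroup) (L L' : List ι), IsIncPath b κ u L v → IsIncPath b κ u L' v →
      L.length = n → L'.length = n → L = L' := by
  induction n with
  | zero =>
    intro u v L L' _ _ h h'
    rw [List.length_eq_zero_iff.mp h, List.length_eq_zero_iff.mp h']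
  | succ n ih =>
    have tail : ∀ (u v : P.weylGroup) (β : ι) (L L' : List ι), IsIncPath b κ u (β :: L) v →
        IsIncPath b κ u (β :: L') v → L.length = n → L'.length = n → L = L' := by
      intro u v β L L' h h' hL hL'
      obtain ⟨y, e, h, -⟩ := isIncPath_cons.mp h
      obtain ⟨y', e', h', -⟩ := isIncPath_cons.mp h'
      rw [e'.2.1, ← e.2.1] at h'
      exact ih y v L L' h h' hL hL'
    refine tilted_induction (b := b) ?_ ?_ ?_
    · intro u L L' h h' _ _
      rw [hκ.eq_nil_of_isIncPath h, hκ.eq_nil_of_isIncPath h']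
    · intro a ha u v hu hv _ _ L L' h h' hL hL'
      obtain - | ⟨β, L⟩ := L
      · simp at hL
      obtain - | ⟨β', L'⟩ := L'
      · simp at hL'
      rw [List.length_cons, add_left_inj] at hL hL'
      obtain ⟨L₁, h1, h2, h3⟩ := h.delete_cons hκ ha hu hv
      obtain ⟨L₂, h4, h5, h6⟩ := h'.delete_cons hκ ha hu hv
      obtain rfl := ih _ _ _ _ h1 h4 (h2.trans hL) (h5.trans hL')
      have hββ' : β = β' := by
        rcases h3 with ⟨h7, h8⟩ | ⟨h7, h8⟩ <;> rcases h6 with ⟨h9, h10⟩ | ⟨h9, h10⟩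
        · rw [h8] at h10; exact Option.some.inj h10
        · have := h10 β (List.mem_of_mem_head? h8); omega
        · have := h8 β' (List.mem_of_mem_head? h10); omega
        · rw [h7, h9]
      subst hββ'
      rw [tail u v β L L' h h' hL hL']
    · intro a ha u v hu hv hT L L' h h' hL hL'
      obtain - | ⟨β, L⟩ := L
      · simp at hL
      obtain - | ⟨β', L'⟩ := L'
      · simp at hL'
      obtain ⟨L₁, h1, h2, h3⟩ := h.lift_cons hκ ha hu hv
      obtain ⟨L₂, h4, h5, h6⟩ := h'.lift_cons hκ ha hu hv
      obtain rfl := hT _ _ h1 h4 (h2.trans hL) (h5.trans hL')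
      rw [List.length_cons, add_left_inj] at hL hL'
      have hββ' : β = β' := by
        rcases h3 with ⟨h7, h8⟩ | ⟨h7, h8, h9⟩ | ⟨h7, h8⟩ <;>
          rcases h6 with ⟨h10, h11⟩ | ⟨h10, h11, h12⟩ | ⟨h10, h11⟩
        · rw [h8] at h11; exact Option.some.inj h11
        · have := h11 β (List.mem_of_mem_head? h8); omega
        · rw [h11, List.head?_cons] at h8
          rw [Option.some.inj h8] at h10; omega
        · have := h8 β' (List.mem_of_mem_head? h11); omega
        · rw [h7, h10]
        · exact absurd (h11 ▸ h'.1) (h9 v)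
        · rw [h8, List.head?_cons] at h11
          rw [Option.some.inj h11] at h7; omega
        · exact absurd (h8 ▸ h.1) (h12 v)
        · exact (List.cons.inj (h8.symm.trans h11)).1
      subst hββ'
      rw [tail u v β L L' h h' hL hL']

/-- There is exactly one increasing path from `u` to `v`. -/
theorem IsIncPath.unique (hκ : IsReflectionOrder b κ) (h : IsIncPath b κ u L v)
    (h' : IsIncPath b κ u L' v) : L = L' :=
  IsIncPath.eq_of_length_eq hκ _ u v L L' h h' rfl
    (le_antisymm ((increasing_path hκ u v).2 _ _ h' h.1) ((increasing_path hκ u v).2 _ _ h h'.1))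

/-- The first label of the increasing path is at most the first label of any shortest path. -/
theorem exists_isIncPath_head_le (hκ : IsReflectionOrder b κ) (n : ℕ) :
    ∀ (β : ι) (q : List ι), κ β = n → IsPath b u (β :: q) v →
      (∀ L', IsPath b u L' v → (β :: q).length ≤ L'.length) →
      ∃ γ L, IsIncPath b κ u (γ :: L) v ∧ κ γ ≤ κ β := by
  induction n using Nat.strong_induction_on with
  | _ n ih =>
  rintro β q rfl hp hmin
  obtain ⟨y, e, hq⟩ := isPath_cons.mp hp
  -- The tail may be taken increasing; only the first two labels can then be out of order, and
  -- replacing them lowers the first label.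
  obtain ⟨⟨q', hq'⟩, hqmin⟩ := increasing_path hκ y v
  have hlen := hqmin q' q hq' hq
  obtain - | ⟨k, q'⟩ := q'
  · exact ⟨β, [], isIncPath_cons.mpr ⟨y, e, hq', by simp⟩, le_rfl⟩
  rcases lt_or_ge (κ β) (κ k) with hlt | hge
  · exact ⟨β, k :: q', isIncPath_cons.mpr ⟨y, e, hq', hq'.lt_of_lt hlt⟩, le_rfl⟩
  obtain ⟨x, e', hx, -⟩ := isIncPath_cons.mp hq'
  have hxu : x = u * (refl P β * refl P k) := by rw [e'.2.1, e.2.1, mul_assoc]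
  have hk : κ k < κ β := by
    refine lt_of_le_of_ne hge fun h => ?_
    rw [hκ.inj _ _ e'.1 e.1 h, refl_mul_self, mul_one] at hxu
    have := hmin q' (hxu ▸ hx.1)
    simp at this hlen
    omega
  obtain ⟨⟨G, hG⟩, hGmin⟩ := increasing_path hκ u x
  have hG2 : G.length ≤ 2 := hGmin G [β, k] hG (.cons e (.cons e' (.nil _)))
  have hG2' := hmin _ (hG.1.append hx.1)
  rw [List.length_append] at hG2'
  simp only [List.length_cons] at hG2' hlen
  have hG3 : G.length = 2 := by omega
  obtain ⟨γ, γ', rfl⟩ := List.length_eq_two.mp hG3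
  have hpos := hG.1.isPos
  have hγγ' : κ γ < κ γ' := by simpa using hG.2
  have hprod : refl P β * refl P k = refl P γ * refl P γ' := by
    have := hG.1.eq_mul
    rw [hxu] at this
    simpa using this
  have hprod' : refl P k * (refl P β * (refl P γ * refl P γ')) = 1 := by
    rw [← hprod, refl_mul_refl_mul, refl_mul_self]
  simp only [List.mem_cons, List.not_mem_nil, or_false, forall_eq_or_imp, forall_eq] at hpos
  -- Otherwise `k, β, γ, γ'`, or `k, γ'` when `γ = β`, would be a nonempty increasing sequence of
  -- reflections with trivial product.
  have hγβ : κ γ < κ β := by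
    by_contra hge'
    rcases (not_lt.mp hge').eq_or_lt with h | h
    · have := hκ.eq_nil [k, γ'] (by simpa using ⟨e'.1, hpos.2⟩)
        (by simpa using hk.trans (h ▸ hγγ'))
        (by simpa [hκ.inj _ _ e.1 hpos.1 h] using hprod')
      simp at this
    · have := hκ.eq_nil [k, β, γ, γ'] (by simpa using ⟨e'.1, e.1, hpos⟩)
        (by simp; omega) (by simpa using hprod')
      simp at this
  obtain ⟨δ, L, hL, hδ⟩ := ih _ hγβ γ (γ' :: q') rfl (hG.1.append hx.1) (by
    intro L' hL'
    have := hmin L' hL'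
    simp at this hlen ⊢
    omega)
  exact ⟨δ, L, hL, hδ.trans hγβ.le⟩

end

/-! ### Root sequences of reduced words as reflection orders -/

/-- The sequence of roots `s_{i_n} ⋯ s_{i_{k+1}} α_{i_k}` of a word `i_1, …, i_n`. -/
noncomputable def rootSeq (b : P.Base) : List b.support → List ι
  | [] => []
  | i :: l => (wordProd b l)⁻¹ • (i : ι) :: rootSeq b l

@[simp] theorem rootSeq_nil : rootSeq b [] = [] := rfl

@[simp] theorem rootSeq_cons (i : b.support) (l : List b.support) :
    rootSeq b (i :: l) = (wordProd b l)⁻¹ • (i : ι) :: rootSeq b l := rfl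

@[simp] theorem length_rootSeq (l : List b.support) : (rootSeq b l).length = l.length := by
  induction l with
  | nil => rfl
  | cons i l ih => simp [ih]

theorem rootSeq_drop (l : List b.support) (n : ℕ) :
    rootSeq b (l.drop n) = (rootSeq b l).drop n := by
  induction l generalizing n with
  | nil => simp
  | cons i l ih => cases n <;> simp [ih]

theorem getElem_rootSeq (l : List b.support) (n : ℕ) (h : n < l.length) :
    (rootSeq b l)[n]'(by simpa using h) = (wordProd b (l.drop (n + 1)))⁻¹ • (l[n] : ι) := by
  induction l generalizing n with
  | nil => simp at h
  | cons i l ih =>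
    cases n with
    | zero => simp
    | succ n => simpa using ih n (by simpa using h)

/-- Right multiplication by the reflection in the root of a letter deletes that letter; taken from
left to right, the deletions do not disturb the roots of later letters. -/
theorem len_wordProd_mul_add_le {L : List ι} {l : List b.support} (h : L.Sublist (rootSeq b l)) :
    len b (wordProd b l * (L.map (refl P)).prod) + L.length ≤ l.length := by
  induction l generalizing L with
  | nil =>
    rw [rootSeq_nil, List.sublist_nil] at h
    simp [h]
  | cons i l ih =>
    rw [rootSeq_cons] at h
    rcases List.sublist_cons_iff.mp h with h' | ⟨L, rfl, h'⟩
    · have h1 := ih h'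
      have h2 := len_mul_le (b := b) (refl P i) (wordProd b l * (L.map (refl P)).prod)
      have h3 := len_refl_le_one i.2
      rw [wordProd_cons, mul_assoc, List.length_cons]
      omega
    · have h1 := ih h'
      rw [List.map_cons, List.prod_cons, wordProd_cons, ← mul_assoc, mul_assoc _ _ (refl P _),
        mul_refl_eq, smul_inv_smul, refl_mul_refl_mul, List.length_cons, List.length_cons]
      omega

theorem IsReducedWord.of_cons {i : b.support} {l : List b.support} {w : P.weylGroup}
    (h : IsReducedWord b (i :: l) w) : IsReducedWord b l (wordProd b l) := by
  refine ⟨rfl, le_antisymm ?_ (len_wordProd_le l)⟩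
  have h1 := len_mul_le (b := b) (refl P i) (wordProd b l)
  have h2 := len_refl_le_one i.2
  rw [← wordProd_cons, h.1, ← h.2, List.length_cons] at h1
  omega

theorem IsReducedWord.drop {l : List b.support} {w : P.weylGroup}
    (h : IsReducedWord b l w) (n : ℕ) : IsReducedWord b (l.drop n) (wordProd b (l.drop n)) := by
  induction l generalizing n w with
  | nil => simp [IsReducedWord]
  | cons i l ih =>
    cases n with
    | zero => exact ⟨rfl, by rw [List.drop_zero, h.1]; exact h.2⟩
    | succ n => exact ih h.of_cons n

theorem IsReducedWord.isPos_cons {i : b.support} {l : List b.support} {w : P.weylGroup}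
    (h : IsReducedWord b (i :: l) w) : b.IsPos ((wordProd b l)⁻¹ • (i : ι)) := by
  by_contra h'
  have h1 := len_simple_mul_of_not_isPos i.2 h'
  have h2 := len_wordProd_le l
  rw [← wordProd_cons, h.1, ← h.2, List.length_cons] at h1
  omega

theorem IsReducedWord.mem_rootSeq {l : List b.support} {w : P.weylGroup}
    (h : IsReducedWord b l w) {β : ι} : β ∈ rootSeq b l ↔ β ∈ inversions b w := by
  classical
  induction l generalizing w with
  | nil => simp [← h.1, mem_inversions]
  | cons i l ih =>
    rw [← h.1, wordProd_cons, inversions_simple_mul i.2 h.isPos_cons, Finset.mem_insert,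
      ← ih h.of_cons, rootSeq_cons, List.mem_cons]

theorem IsReducedWord.nodup_rootSeq {l : List b.support} {w : P.weylGroup}
    (h : IsReducedWord b l w) : (rootSeq b l).Nodup := by
  induction l generalizing w with
  | nil => simp
  | cons i l ih =>
    rw [rootSeq_cons, List.nodup_cons]
    refine ⟨?_, ih h.of_cons⟩
    rw [h.of_cons.mem_rootSeq, mem_inversions, smul_inv_smul]
    exact fun h => h.2 (b.isPos_of_mem_support i.2)

theorem mem_drop_iff_le_idxOf [DecidableEq ι] {B : List ι} (hB : B.Nodup) {β : ι} (hβ : β ∈ B)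
    (n : ℕ) : β ∈ B.drop n ↔ n ≤ B.idxOf β := by
  induction B generalizing n with
  | nil => simp at hβ
  | cons γ B ih =>
    cases n with
    | zero => simpa using hβ
    | succ n =>
      rw [List.nodup_cons] at hB
      rw [List.drop_succ_cons]
      by_cases h : γ = β
      · subst h
        simp only [List.idxOf_cons_self, Nat.le_zero_eq, Nat.add_eq_zero_iff, one_ne_zero, and_false, iff_false]
        exact fun h => hB.1 (List.mem_of_mem_drop h)
      · rw [List.idxOf_cons_ne _ h, ih hB.2 (by simpa [Ne.symm h] using hβ)]
        omega

theorem sublist_of_pairwise_idxOf [DecidableEq ι] {B L : List ι} (hL : ∀ β ∈ L, β ∈ B)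
    (h : L.Pairwise (B.idxOf · < B.idxOf ·)) : L.Sublist B := by
  induction B generalizing L with
  | nil =>
    obtain rfl : L = [] := List.eq_nil_iff_forall_not_mem.mpr fun β hβ => by simpa using hL β hβ
    exact .slnil
  | cons γ B ih =>
    have key : ∀ L : List ι, (∀ β ∈ L, β ∈ γ :: B) → (∀ β ∈ L, β ≠ γ) →
        L.Pairwise ((γ :: B).idxOf · < (γ :: B).idxOf ·) → L.Sublist B := by
      intro L h1 h2 h3
      refine ih (fun β hβ => by simpa [h2 β hβ] using h1 β hβ) (h3.imp_of_mem ?_)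
      intro β δ hβ hδ h4
      rw [List.idxOf_cons_ne _ (h2 β hβ).symm, List.idxOf_cons_ne _ (h2 δ hδ).symm] at h4
      omega
    obtain - | ⟨β, L⟩ := L
    · exact List.nil_sublist _
    rw [List.pairwise_cons] at h
    have hne : ∀ δ ∈ L, δ ≠ γ := by
      rintro δ hδ rfl
      have := h.1 _ hδ
      simp at this
    by_cases hβ : β = γ
    · subst hβ
      exact (key L (fun δ hδ => hL δ (by simp [hδ])) hne h.2).cons_cons _
    · exact (key (β :: L) hL (by simpa [hβ] using hne) (List.pairwise_cons.mpr h)).cons _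

open Classical in
/-- The position of a root in the root sequence of a word. -/
noncomputable def wordOrder (b : P.Base) (l : List b.support) (β : ι) : ℕ := (rootSeq b l).idxOf β

section Longest

variable {l : List b.support} {w : P.weylGroup} (hl : IsReducedWord b l w) (hw : IsLongest b w)
include hl hw

theorem IsReducedWord.mem_rootSeq_of_isLongest {β : ι} (hβ : b.IsPos β) : β ∈ rootSeq b l := by
  rw [hl.mem_rootSeq, mem_inversions]
  exact ⟨hβ, fun h => (lt_len_mul_refl hβ h).not_ge (hw _)⟩

theorem IsReducedWord.le_wordOrder_iff {β : ι} (hβ : b.IsPos β) (n : ℕ) :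
    n ≤ wordOrder b l β ↔ ¬ b.IsPos (wordProd b (l.drop n) • β) := by
  classical
  rw [wordOrder, ← mem_drop_iff_le_idxOf hl.nodup_rootSeq (hl.mem_rootSeq_of_isLongest hw hβ),
    ← rootSeq_drop, (hl.drop n).mem_rootSeq, mem_inversions]
  tauto

theorem IsReducedWord.isReflectionOrder : IsReflectionOrder b (wordOrder b l) where
  inj β γ hβ _ h := by
    classical
    exact (List.idxOf_inj (hl.mem_rootSeq_of_isLongest hw hβ)).mp h
  seg n := ⟨_, fun _ hβ => hl.le_wordOrder_iff hw hβ n⟩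
  -- A trivial product would still delete `L.length` letters from a reduced word without changing
  -- its value.
  eq_nil L hL hLp h := by
    classical
    have := len_wordProd_mul_add_le
      (sublist_of_pairwise_idxOf (fun β hβ => hl.mem_rootSeq_of_isLongest hw (hL β hβ)) hLp)
    rw [h, mul_one, hl.1, hl.2] at this
    exact List.length_eq_zero_iff.mp (by omega)

end Longest

theorem isLongest_of_forall_not_isPos {y : P.weylGroup}
    (h : ∀ i ∈ b.support, ¬ b.IsPos (y⁻¹ • i)) : IsLongest b y := by
  intro x
  rw [← len_inv x, ← len_inv y, ← card_inversions, ← card_inversions]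
  refine Finset.card_le_card fun β hβ => ?_
  rw [mem_inversions] at hβ ⊢
  refine ⟨hβ.1, ?_⟩
  obtain ⟨f, hf, hsum⟩ := exists_root_eq_sum_of_isPos hβ.1
  rw [Base.isPos_iff, height_smul_eq_sum_mul hsum, not_lt]
  exact Finset.sum_nonpos fun i hi =>
    mul_nonpos_of_nonneg_of_nonpos (hf i) (not_lt.mp (h i hi))

/-- As long as the product is not longest, some simple reflection on the left lengthens it; the
number of roots bounds the process. -/
theorem nonempty_reducedExtension (b : P.Base) (w : P.weylGroup) :
    Nonempty (ReducedExtension b w) := by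
  obtain ⟨r, hr⟩ := exists_isReducedWord b w
  have key : ∀ (n : ℕ) (l : List b.support), Fintype.card ι - (l ++ r).length = n →
      IsReducedWord b (l ++ r) (wordProd b (l ++ r)) → Nonempty (ReducedExtension b w) := by
    intro n
    induction n using Nat.strong_induction_on with
    | _ n ih =>
    intro l hn hl
    by_cases hlong : IsLongest b (wordProd b (l ++ r))
    · exact ⟨⟨r, l, hr, hl, hlong⟩⟩
    · obtain ⟨i, hi, hpos⟩ : ∃ i ∈ b.support, b.IsPos ((wordProd b (l ++ r))⁻¹ • i) := by
        by_contra! h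
        exact hlong (isLongest_of_forall_not_isPos h)
      have h1 := len_simple_mul_of_isPos hi hpos
      have h2 : len b (refl P i * wordProd b (l ++ r)) ≤ Fintype.card ι := by
        rw [← card_inversions]; exact Finset.card_le_univ _
      have h3 := hl.2
      refine ih _ ?_ (⟨i, hi⟩ :: l) rfl ⟨rfl, ?_⟩
      · rw [List.cons_append, List.length_cons]
        omega
      · rw [List.cons_append, wordProd_cons, h1, List.length_cons, h3]
  exact key _ [] rfl ⟨rfl, by rw [List.nil_append, hr.1]; exact hr.2⟩

/-! ### Distances, the tilted order and the description of `EQB` -/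

theorem isIncPath_dist {κ : ι → ℕ} (hκ : IsReflectionOrder b κ) {u v : P.weylGroup} {L : List ι}
    (h : IsIncPath b κ u L v) : dist b u v = L.length := by
  refine le_antisymm (Nat.sInf_le ⟨L, h.1, rfl⟩) ?_
  refine le_csInf ⟨_, L, h.1, rfl⟩ ?_
  rintro n ⟨L', h', rfl⟩
  exact (increasing_path hκ u v).2 L L' h h'

theorem len_lt_of_bruhatLT {u v : P.weylGroup} (h : BruhatLT b u v) : len b u < len b v := by
  induction h with
  | single h => exact h.2
  | tail _ h ih => exact ih.trans h.2

theorem tiltedLE_iff {κ : ι → ℕ} (hκ : IsReflectionOrder b κ) {w z u : P.weylGroup} :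
    TiltedLE b w z u ↔ ∃ L₁ L₂ : List ι, IsPath b w L₁ z ∧ IsPath b z L₂ u ∧
      (L₁ ++ L₂).length = dist b w u := by
  obtain ⟨L₁, h₁⟩ := (increasing_path hκ w z).1
  obtain ⟨L₂, h₂⟩ := (increasing_path hκ z u).1
  obtain ⟨L, h⟩ := (increasing_path hκ w u).1
  rw [TiltedLE, isIncPath_dist hκ h₁, isIncPath_dist hκ h₂, isIncPath_dist hκ h]
  constructor
  · intro h
    exact ⟨L₁, L₂, h₁.1, h₂.1, by rw [List.length_append, h]⟩
  · rintro ⟨L₁', L₂', h₁', h₂', hlen⟩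
    have h3 := (increasing_path hκ w z).2 _ _ h₁ h₁'
    have h4 := (increasing_path hκ z u).2 _ _ h₂ h₂'
    have h5 := (increasing_path hκ w u).2 _ _ h (h₁.1.append h₂.1)
    rw [List.length_append] at hlen h5
    omega

namespace ReducedExtension

variable {w u : P.weylGroup} (c : ReducedExtension b w)

theorem isReflectionOrder : IsReflectionOrder b (wordOrder b c.word) :=
  c.word_reduced.isReflectionOrder c.word_longest

theorem beta_eq (k : Fin c.word.length) :
    c.beta k = (rootSeq b c.word)[(k : ℕ)]'(by simp) := by
  rw [getElem_rootSeq _ _ k.2]; rfl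

theorem wordOrder_beta (k : Fin c.word.length) : wordOrder b c.word (c.beta k) = k := by
  classical
  rw [wordOrder, beta_eq]
  exact List.Nodup.idxOf_getElem c.word_reduced.nodup_rootSeq _ _

theorem exists_beta_eq {β : ι} (hβ : b.IsPos β) : ∃ k, c.beta k = β := by
  obtain ⟨n, hn, h⟩ := List.mem_iff_getElem.mp
    (c.word_reduced.mem_rootSeq_of_isLongest c.word_longest hβ)
  exact ⟨⟨n, by rwa [length_rootSeq] at hn⟩, by rw [beta_eq]; exact h⟩

/-- The roots at these positions form the root sequence of `right`, a reduced word of `w`; this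
turns `j_1 ≥ 1` into a condition on inversions. -/
theorem le_wordOrder_iff {β : ι} (hβ : b.IsPos β) :
    c.left.length ≤ wordOrder b c.word β ↔ ¬ b.IsPos (w • β) := by
  rw [word, c.word_reduced.le_wordOrder_iff c.word_longest hβ, List.drop_left, c.right_reduced.1]

theorem mem_EQB_iff : u ∈ EQB c ↔ ∃ L, IsIncPath b (wordOrder b c.word) w L u ∧
    ∀ β ∈ L.head?, ¬ b.IsPos (w • β) := by
  constructor
  · rintro ⟨j, ⟨h1, h2, -⟩, h4⟩
    refine ⟨_, ⟨h2, ?_⟩, ?_⟩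
    · rw [List.pairwise_map]
      exact h1.imp fun h => by rw [wordOrder_beta, wordOrder_beta]; exact h
    · obtain - | ⟨k, j⟩ := j
      · simp
      · have h5 := h4 k (by simp)
        rw [← c.wordOrder_beta k, c.le_wordOrder_iff (h2.isPos _ (by simp))] at h5
        simpa using h5
  · rintro ⟨L, h, h'⟩
    obtain ⟨j, rfl⟩ : ∃ j : List (Fin c.word.length), j.map c.beta = L := by
      have := h.1.isPos
      clear h h'
      induction L with
      | nil => exact ⟨[], rfl⟩
      | cons β L ih =>
        obtain ⟨k, hk⟩ := c.exists_beta_eq (this β (by simp))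
        obtain ⟨j, hj⟩ := ih fun γ hγ => this γ (by simp [hγ])
        exact ⟨k :: j, by rw [List.map_cons, hk, hj]⟩
    refine ⟨j, ⟨?_, h.1, ?_⟩, ?_⟩
    · have := h.2
      rw [List.pairwise_map] at this
      exact this.imp fun h => by rwa [wordOrder_beta, wordOrder_beta] at h
    · rw [isIncPath_dist c.isReflectionOrder h, List.length_map]
    · obtain - | ⟨k, j⟩ := j
      · simp
      · have h5 := h' (c.beta k) (by simp)
        rw [← c.le_wordOrder_iff (h.1.isPos _ (by simp)), wordOrder_beta] at h5
        simpa using h5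

/-- An increasing path out of `w` whose labels are inversions of `w` does not lead to a longer
element. -/
theorem len_le_of_isIncPath {L : List ι} (h : IsIncPath b (wordOrder b c.word) w L u)
    (h' : ∀ β ∈ L.head?, ¬ b.IsPos (w • β)) : len b u ≤ len b w := by
  classical
  -- Inversions of `w` form a final segment of the order, so the condition on the first label passes
  -- to all labels.
  have hmem : ∀ β ∈ L, ¬ b.IsPos (w • β) := by
    obtain - | ⟨γ, L⟩ := L
    · simp
    have h1 := h' γ (by simp)
    have h2 := h.1.isPos
    rw [← c.le_wordOrder_iff (h2 γ (by simp))] at h1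
    obtain ⟨_, -, -, h3⟩ := isIncPath_cons.mp h
    intro β hβ
    rw [← c.le_wordOrder_iff (h2 β hβ)]
    rcases List.mem_cons.mp hβ with rfl | hβ
    · exact h1
    · exact h1.trans (h3 β hβ).le
  have hright : ∀ β ∈ L, β ∈ rootSeq b c.right := fun β hβ => by
    rw [c.right_reduced.mem_rootSeq, mem_inversions]
    exact ⟨h.1.isPos β hβ, hmem β hβ⟩
  have hsplit : (rootSeq b c.word).take c.left.length ++ rootSeq b c.right = rootSeq b c.word := by
    rw [show c.right = c.word.drop c.left.length by rw [word, List.drop_left], rootSeq_drop,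
      List.take_append_drop]
  have hdisj := c.word_reduced.nodup_rootSeq
  have hsub := sublist_of_pairwise_idxOf
    (fun β hβ => c.word_reduced.mem_rootSeq_of_isLongest c.word_longest (h.1.isPos β hβ)) h.2
  change (rootSeq b c.word).Nodup at hdisj
  change L.Sublist (rootSeq b c.word) at hsub
  rw [← hsplit] at hdisj hsub
  obtain ⟨L₁, L₂, rfl, h₁, h₂⟩ := List.sublist_append_iff.mp hsub
  obtain rfl : L₁ = [] := List.eq_nil_iff_forall_not_mem.mpr fun β hβ =>
    List.disjoint_of_nodup_append hdisj (h₁.subset hβ) (hright β (by simp [hβ]))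
  rw [List.nil_append] at h
  have := len_wordProd_mul_add_le h₂
  rw [c.right_reduced.1, ← h.1.eq_mul, c.right_reduced.2] at this
  omega

theorem mem_EQB_iff_forall_not : u ∈ EQB c ↔ ¬ ∃ (z : P.weylGroup) (L₁ L₂ : List ι),
    BruhatLT b w z ∧ IsPath b w L₁ z ∧ IsPath b z L₂ u ∧ (L₁ ++ L₂).length = dist b w u := by
  have hκ := c.isReflectionOrder
  rw [mem_EQB_iff]
  constructor
  · rintro ⟨L, hL, hhead⟩ ⟨z, L₁, L₂, hz, h₁, h₂, hlen⟩
    rw [isIncPath_dist hκ hL, List.length_append] at hlen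
    replace hz := len_lt_of_bruhatLT hz
    obtain ⟨⟨A, hA⟩, hAmin⟩ := increasing_path hκ w z
    have hA₁ := hAmin A L₁ hA h₁
    obtain - | ⟨k, A⟩ := A
    · rw [hA.1.eq_nil_iff] at hz
      omega
    have hk : b.IsPos (w • k) := by
      by_contra hk
      exact (c.len_le_of_isIncPath hA (by simpa using hk)).not_gt hz
    have hmin := (increasing_path hκ w u).2 L
    -- The increasing path to `z` followed by `L₂` is again a shortest path to `u`, with first label
    -- `k`.
    obtain ⟨γ, L', hL', hγ⟩ := exists_isIncPath_head_le hκ _ k (A ++ L₂) rfl (hA.1.append h₂) (by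
      intro L' hL'
      have := hmin L' hL hL'
      simp only [List.length_cons, List.length_append] at hA₁ ⊢
      omega)
    obtain rfl := hL.unique hκ hL'
    have h3 := hhead γ (by simp)
    rw [← c.le_wordOrder_iff (hL.1.isPos γ (by simp))] at h3
    exact (c.le_wordOrder_iff (hA.1.isPos k (by simp))).mp (h3.trans hγ) hk
  · intro h
    obtain ⟨⟨L, hL⟩, -⟩ := increasing_path hκ w u
    refine ⟨L, hL, fun β hβ hpos => h ?_⟩
    obtain - | ⟨β', L⟩ := L
    · simp at hβ
    obtain rfl : β' = β := by simpa using hβ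
    obtain ⟨y, e, hy⟩ := isPath_cons.mp hL.1
    -- The witness `z` is the end of the first edge, which goes up because `w β'` is positive.
    refine ⟨y, [β'], L, .single ⟨⟨β', e.2.1⟩, ?_⟩, .cons e (.nil _), hy, ?_⟩
    · rw [e.2.1]; exact lt_len_mul_refl e.1 hpos
    · rw [isIncPath_dist hκ hL]; rfl

end ReducedExtension

end

end QuantumBruhat

theorem mainTheorem4 {ι K M N : Type*} [Fintype ι] [Field K] [CharZero K]
    [AddCommGroup M] [Module K M] [AddCommGroup N] [Module K N]
    (P : RootPairing ι K M N) [P.IsRootSystem] [P.IsCrystallographic] [P.IsReduced]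
    (b : P.Base) (w : P.weylGroup) :
    Nonempty (QuantumBruhat.ReducedExtension b w) ∧
    ∀ c : QuantumBruhat.ReducedExtension b w,
      QuantumBruhat.EQB c =
        {u | ¬ ∃ z : P.weylGroup, QuantumBruhat.BruhatLT b w z ∧ QuantumBruhat.TiltedLE b w z u} ∧
      QuantumBruhat.EQB c =
        {u | ¬ ∃ (z : P.weylGroup) (L₁ L₂ : List ι), QuantumBruhat.BruhatLT b w z ∧
          QuantumBruhat.IsPath b w L₁ z ∧ QuantumBruhat.IsPath b z L₂ u ∧
          (L₁ ++ L₂).length = QuantumBruhat.dist b w u} := by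
  refine ⟨QuantumBruhat.nonempty_reducedExtension b w, fun c => ⟨?_, ?_⟩⟩
  · ext u
    rw [c.mem_EQB_iff_forall_not]
    simp only [QuantumBruhat.tiltedLE_iff c.isReflectionOrder, Set.mem_ofPred_eq, exists_and_left]
  · ext u
    exact c.mem_EQB_iff_forall_not
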